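/- Let $\tau$ range over the upper half-plane $\mathbb H$. Let $\wp(z)=\wp(z;\tau)$ be the Weierstrass function with period lattice $\Lambda_\tau=\mathbb Z+\mathbb Z\tau$ and $\wp'=\partial\wp/\partial z$. Put $\omega_1=1/2$, $\omega_3=\tau/2$, $\omega_2=-\omega_1-\omega_3$, $e_i=\wp(\omega_i)$ for $i=1,2,3$, and $$t=t(\tau)=\frac{e_3-e_1}{e_2-e_1}.$$ Let $\kappa_0,\kappa_1,\kappa_t,\kappa_\infty\in\mathbb C$ and $\tau_0\in\mathbb H$. A function $\delta$ of $\tau$, holomorphic near $\tau_0$ with $\delta(\tau_0)\notin\Lambda_{\tau_0}$, and a function $\lambda$ of $t$, holomorphic near $t(\tau_0)$, are called related at $\tau_0$ if $$\lambda(t(\tau))=\frac{\wp(\delta(\tau);\tau)-e_1}{e_2-e_1}\qquad\text{for all }\tau\text{ near }\tau_0 .$$ Then every such $\delta$ is related at $\tau_0$ to some $\lambda$; every $\lambda$ holomorphic near $t(\tau_0)$ with $\lambda(t(\tau_0))\notin\{0,1,t(\tau_0)\}$ is related at $\tau_0$ to some $\delta$; and if $\delta$ and $\lambda$ are related at $\tau_0$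 and $\lambda(t(\tau_0))\notin\{0,1,t(\tau_0)\}$, then the sixth Painlevé equation $$\begin{aligned}\frac{d^2\lambda}{dt^2}={}&\frac12\left(\frac1\lambda+\frac1{\lambda-1}+\frac1{\lambda-t}\right)\left(\frac{d\lambda}{dt}\right)^2-\left(\frac1t+\frac1{t-1}+\frac1{\lambda-t}\right)\frac{d\lambda}{dt}\\&+\frac{\lambda(\lambda-1)(\lambda-t)}{t^2(t-1)^2}\left\{\frac{\kappa_\infty^2}2-\frac{\kappa_0^2}2\frac t{\lambda^2}+\frac{\kappa_1^2}2\frac{t-1}{(\lambda-1)^2}+\frac{1-\kappa_t^2}2\frac{t(t-1)}{(\lambda-t)^2}\right\}\end{aligned}$$ holds at $t=t(\tau_0)$ if and only if $$\frac{d^2\delta}{d\tau^2}=-\frac1{4\pi^2}\left\{\frac{\kappa_\infty^2}2\wp'(\delta)+\frac{\kappa_0^2}2\wp'\!\left(\delta+\tfrac12\right)+\frac{\kappa_1^2}2\wp'\!\left(\delta+\tfrac{\tau+1}2\right)+\frac{\kappa_t^2}2\wp'\!\left(\delta+\tfrac\tau2\right)\right\}$$ holds at $\tau=\tau_0$. 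-/

import Mathlib

open scoped Topology UpperHalfPlane

noncomputable section

namespace EllipticPVI

/-- The pair of periods `(2ω₁, 2ω₃) = (1, τ)`. -/
def periods (τ : ℍ) : PeriodPair where
  ω₁ := 1
  ω₂ := τ
  indep := by
    rw [LinearIndependent.pair_iff]
    intro a b h
    have him := congrArg Complex.im h
    have hre := congrArg Complex.re h
    have hb : b = 0 := by
      simpa [τ.im_ne_zero] using him
    subst hb
    simpa using hre

/-- The Weierstrass function `z ↦ ℘(z)` with periods `1` and `τ`. -/
def wp (τ : ℍ) (z : ℂ) : ℂ := (periods τ).weierstrassP z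

/-- Its derivative `℘'(z) = (∂/∂z) ℘(z)` in the variable `z`. -/
def wpDeriv (τ : ℍ) (z : ℂ) : ℂ := (periods τ).derivWeierstrassP z

/-- `e₁ = ℘(ω₁)` with `ω₁ = 1/2`. -/
def e₁ (τ : ℍ) : ℂ := wp τ (1 / 2)

/-- `e₂ = ℘(ω₂)` with `ω₂ = -ω₁ - ω₃`. -/
def e₂ (τ : ℍ) : ℂ := wp τ (-(1 / 2) - (τ : ℂ) / 2)

/-- `e₃ = ℘(ω₃)` with `ω₃ = τ/2`. -/
def e₃ (τ : ℍ) : ℂ := wp τ ((τ : ℂ) / 2)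

/-- The modular function `t = (e₃ - e₁) / (e₂ - e₁)`. -/
def tMod (τ : ℍ) : ℂ := (e₃ τ - e₁ τ) / (e₂ τ - e₁ τ)

/-- The relation `λ(t) = (℘(δ) - e₁) / (e₂ - e₁)`, `t = t(τ)`, `δ = δ(τ)`, for all `τ` near `τ₀`. -/
def Related (τ₀ : ℍ) (δ lam : ℂ → ℂ) : Prop :=
  ∀ᶠ τ : ℍ in 𝓝 τ₀, lam (tMod τ) = (wp τ (δ τ) - e₁ τ) / (e₂ τ - e₁ τ)

/-- The sixth Painlevé equation for the function `lam`, at the point `t`. -/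
def PVIAt (κ₀ κ₁ κt κinf : ℂ) (lam : ℂ → ℂ) (t : ℂ) : Prop :=
  deriv (deriv lam) t =
    1 / 2 * (1 / lam t + 1 / (lam t - 1) + 1 / (lam t - t)) * deriv lam t ^ 2
      - (1 / t + 1 / (t - 1) + 1 / (lam t - t)) * deriv lam t
      + lam t * (lam t - 1) * (lam t - t) / (t ^ 2 * (t - 1) ^ 2) *
        (κinf ^ 2 / 2 - κ₀ ^ 2 / 2 * (t / lam t ^ 2)
          + κ₁ ^ 2 / 2 * ((t - 1) / (lam t - 1) ^ 2)
          + (1 - κt ^ 2) / 2 * (t * (t - 1) / (lam t - t) ^ 2))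

/-- The elliptic form of the sixth Painlevé equation for the function `δ`, at the point `τ`. -/
def EllipticPVIAt (κ₀ κ₁ κt κinf : ℂ) (δ : ℂ → ℂ) (τ : ℍ) : Prop :=
  deriv (deriv δ) τ =
    -(1 / (4 * (Real.pi : ℂ) ^ 2)) *
      (κinf ^ 2 / 2 * wpDeriv τ (δ τ)
        + κ₀ ^ 2 / 2 * wpDeriv τ (δ τ + 1 / 2)
        + κ₁ ^ 2 / 2 * wpDeriv τ (δ τ + ((τ : ℂ) + 1) / 2)
        + κt ^ 2 / 2 * wpDeriv τ (δ τ + (τ : ℂ) / 2))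

end EllipticPVI

end

/-! The substitution λ = (℘(δ) - e₁)/(e₂ - e₁) is differentiated twice in τ, and everything rests on
controlling ∂/∂τ of ℘. For this, ℘ is replaced by P = -∂ζ/∂z, where ζ(z, τ) is the logarithmic
derivative of the odd theta function, built from geometric series so that joint smoothness in (z, τ)
is available. P differs from ℘ by a function of τ alone (`exists_wp_eq`), which cancels in λ and in
t.

The theta heat equation becomes 4πi ∂ζ/∂τ = ∂/∂z (∂ζ/∂z + ζ²) (`heat_zeta`). It follows from
Liouville's theorem: the difference of the two sides is elliptic without poles, hence constant, and
odd, hence zero. Write c = 1/(4πi), a = e₂ - e₁, X = λ, T = t and y = ℘'(δ). Evaluating ∂P/∂τ at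
half-periods, where ℘' vanishes, gives T' = 4caT(T - 1) and a formula for a'. Along a curve δ(τ), X'
= y(δ' + 2cζ)/a + 4caX(X - 1) (`hasDerivAt_normP_comp`). The derivative of δ' + 2cζ involves ζ only
through this same combination, and y' comes from y² = 4a³X(X - 1)(X - T). A rational identity
(`pvi_identity`) then shows that all first-order terms cancel: the defect of the Painlevé equation
times T'² equals y/a times the defect of the elliptic equation. The four terms in the κ's match
because ℘'(z + ω) is a rational multiple of ℘'(z) for a half-period ω (`wpDeriv_add_half`).

For λ ∉ {0, 1, t} one has y ≠ 0, so the two defects vanish together; the same fact lets the implicit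
function theorem produce δ from λ. In the other direction λ is produced from δ by locally inverting
t(τ), as T' ≠ 0. -/

namespace EllipticPVI

open Filter Set

/-! ### Series `∑ nᵏ β(z + n τ)` -/

/-- Holomorphic functions on the upper half-plane which decay exponentially at `i∞`. -/
def IsDecaying (β : ℂ → ℂ) : Prop :=
  DifferentiableOn ℂ β {w | 0 < w.im} ∧
    ∀ ε : ℝ, 0 < ε → ∃ M : ℝ, ∀ w : ℂ, ε ≤ w.im → ‖β w‖ ≤ M * Real.exp (-w.im)

lemma isOpen_im_pos : IsOpen {w : ℂ | 0 < w.im} :=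
  isOpen_lt continuous_const Complex.continuous_im

/-- Cauchy's estimate on the disc of radius ε/2. Closure under differentiation is what makes the
induction in `contDiffOn_shiftSum` run. -/
lemma IsDecaying.deriv {β : ℂ → ℂ} (h : IsDecaying β) : IsDecaying (deriv β) := by
  refine ⟨h.1.deriv isOpen_im_pos, fun ε hε => ?_⟩
  obtain ⟨M, hM⟩ := h.2 (ε / 2) (by linarith)
  refine ⟨2 / ε * (M * Real.exp (ε / 2)), fun w hw => ?_⟩
  have him : ∀ y ∈ Metric.closedBall w (ε / 2), w.im - ε / 2 ≤ y.im := by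
    intro y hy
    have h1 : |(y - w).im| ≤ ε / 2 :=
      (Complex.abs_im_le_norm _).trans (by simpa [dist_eq_norm] using hy)
    have := (abs_le.1 h1).1
    simp only [Complex.sub_im] at this
    linarith
  have hM0 : 0 ≤ M := by
    have := (norm_nonneg _).trans (hM w (by linarith))
    exact nonneg_of_mul_nonneg_left this (Real.exp_pos _)
  have key := Complex.norm_deriv_le_of_forall_mem_sphere_norm_le (c := w) (R := ε / 2) (f := β)
    (C := M * Real.exp (-(w.im - ε / 2))) (by linarith) ?_ ?_
  · refine key.trans (le_of_eq ?_)
    rw [neg_sub, sub_eq_add_neg, Real.exp_add]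
    field_simp
  · refine (h.1.mono fun y hy => ?_).diffContOnCl
    have := him y (Metric.closure_ball_subset_closedBall hy)
    show 0 < y.im
    linarith
  · intro y hy
    have h1 := him y (Metric.sphere_subset_closedBall hy)
    refine (hM y (by linarith)).trans ?_
    gcongr

/-- The series `∑ nᵏ β(z + n τ)` as a function of the pair `(z, τ)`. -/
noncomputable def shiftSum (k : ℕ) (β : ℂ → ℂ) (p : ℂ × ℂ) : ℂ :=
  ∑' n : ℕ, (n : ℂ) ^ k * β (p.1 + n * p.2)

lemma summable_shiftSum {β : ℂ → ℂ} (h : IsDecaying β) (k : ℕ) (z : ℂ) {τ : ℂ} (hτ : 0 < τ.im) :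
    Summable fun n : ℕ => (n : ℂ) ^ k * β (z + n * τ) := by
  obtain ⟨M, hM⟩ := h.2 1 one_pos
  have h1 : ∀ᶠ n : ℕ in atTop, 1 ≤ (z + n * τ).im := by
    have : Tendsto (fun n : ℕ => z.im + n * τ.im) atTop atTop :=
      tendsto_atTop_add_const_left _ _
        (tendsto_natCast_atTop_atTop.atTop_mul_const hτ)
    filter_upwards [this.eventually_ge_atTop 1] with n hn
    simpa using hn
  refine Summable.of_norm_bounded_eventually_nat
    (g := fun n : ℕ => (M * Real.exp (-z.im)) * ((n : ℝ) ^ k * Real.exp (-τ.im * n)))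
    ((Real.summable_pow_mul_exp_neg_nat_mul k hτ).mul_left _) ?_
  filter_upwards [h1] with n hn
  rw [norm_mul, norm_pow, Complex.norm_natCast]
  have h2 := hM _ hn
  have h3 : Real.exp (-(z + n * τ).im) = Real.exp (-z.im) * Real.exp (-τ.im * n) := by
    rw [← Real.exp_add]; congr 1; simp; ring
  rw [h3] at h2
  calc _ ≤ (n : ℝ) ^ k * (M * (Real.exp (-z.im) * Real.exp (-τ.im * n))) := by gcongr
    _ = _ := by ring

/-- Termwise differentiation, with the majorants nᵏ exp(-εn) uniform on the convex set Im z, Im τ >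
ε. Differentiating in τ brings down a factor n, which is why the weights nᵏ are part of the family.
-/
lemma hasFDerivAt_shiftSum {β : ℂ → ℂ} (h : IsDecaying β) (k : ℕ) {p : ℂ × ℂ}
    (hz : 0 < p.1.im) (hτ : 0 < p.2.im) :
    HasFDerivAt (shiftSum k β)
      (shiftSum k (deriv β) p • ContinuousLinearMap.fst ℂ ℂ ℂ +
        shiftSum (k + 1) (deriv β) p • ContinuousLinearMap.snd ℂ ℂ ℂ) p := by
  obtain ⟨ε, hε, hε1, hε2⟩ : ∃ ε > 0, ε < p.1.im ∧ ε < p.2.im :=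
    ⟨min p.1.im p.2.im / 2, by positivity,
      by linarith [min_le_left p.1.im p.2.im], by linarith [min_le_right p.1.im p.2.im]⟩
  obtain ⟨M, hM⟩ := h.deriv.2 ε hε
  let s : Set (ℂ × ℂ) := {p | ε < p.1.im} ∩ {p | ε < p.2.im}
  have hs : IsOpen s := by
    apply IsOpen.inter
    · exact isOpen_lt continuous_const (by fun_prop)
    · exact isOpen_lt continuous_const (by fun_prop)
  have hconv : Convex ℝ s := by
    apply Convex.inter
    · have := (convex_halfSpace_im_gt ε).is_linear_preimage
        (LinearMap.fst ℝ ℂ ℂ).isLinear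
      exact this
    · have := (convex_halfSpace_im_gt ε).is_linear_preimage
        (LinearMap.snd ℝ ℂ ℂ).isLinear
      exact this
  have hp : p ∈ s := ⟨hε1, hε2⟩
  have him : ∀ n : ℕ, ∀ x ∈ s, ε + ε * n ≤ (x.1 + n * x.2).im := by
    intro n x hx
    have h1 : ε < x.1.im := hx.1
    have h2 : ε < x.2.im := hx.2
    have : ε * n ≤ n * x.2.im := by nlinarith [(Nat.cast_nonneg n : (0 : ℝ) ≤ n)]
    simp
    linarith
  have hεn : ∀ n : ℕ, ε ≤ ε + ε * n := fun n => by
    have : 0 ≤ ε * n := by positivity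
    linarith
  have hM0 : 0 ≤ M := by
    have := (norm_nonneg _).trans (hM _ hε1.le)
    exact nonneg_of_mul_nonneg_left this (Real.exp_pos _)
  have key := hasFDerivAt_tsum_of_isPreconnected (𝕜 := ℂ)
    (f := fun (n : ℕ) (x : ℂ × ℂ) => (n : ℂ) ^ k * β (x.1 + n * x.2))
    (f' := fun n x => ((n : ℂ) ^ k * deriv β (x.1 + n * x.2)) • ContinuousLinearMap.fst ℂ ℂ ℂ +
      ((n : ℂ) ^ (k + 1) * deriv β (x.1 + n * x.2)) • ContinuousLinearMap.snd ℂ ℂ ℂ)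
    (u := fun n : ℕ => M * ((n : ℝ) ^ k * Real.exp (-ε * n)) +
      M * ((n : ℝ) ^ (k + 1) * Real.exp (-ε * n)))
    (((Real.summable_pow_mul_exp_neg_nat_mul k hε).mul_left _).add
      ((Real.summable_pow_mul_exp_neg_nat_mul (k + 1) hε).mul_left _))
    hs hconv.isPreconnected ?_ ?_ hp (summable_shiftSum h k _ hτ) hp
  · convert! key using 1
    rw [Summable.tsum_add, Summable.tsum_smul_const (summable_shiftSum h.deriv k _ hτ),
      Summable.tsum_smul_const (summable_shiftSum h.deriv (k + 1) _ hτ)]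
    · rfl
    · exact (summable_shiftSum h.deriv k _ hτ).smul_const _
    · exact (summable_shiftSum h.deriv (k + 1) _ hτ).smul_const _
  · intro n x hx
    have h1 : 0 < (x.1 + n * x.2).im := by linarith [him n x hx, hεn n]
    have h2 : HasDerivAt β (deriv β (x.1 + n * x.2)) (x.1 + n * x.2) :=
      (h.1.differentiableAt (isOpen_im_pos.mem_nhds h1)).hasDerivAt
    have h3 : HasFDerivAt (fun x : ℂ × ℂ => x.1 + n * x.2)
        (ContinuousLinearMap.fst ℂ ℂ ℂ + (n : ℂ) • ContinuousLinearMap.snd ℂ ℂ ℂ) x :=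
      hasFDerivAt_fst.add (hasFDerivAt_snd.const_mul _)
    convert! (h2.comp_hasFDerivAt x h3).const_mul ((n : ℂ) ^ k) using 1
    ext
    · simp
    · simp
      ring
  · intro n x hx
    have h1 := hM _ ((hεn n).trans (him n x hx))
    have h2 : ‖deriv β (x.1 + n * x.2)‖ ≤ M * Real.exp (-ε * n) := by
      refine h1.trans ?_
      gcongr
      linarith [him n x hx]
    have hf : ‖ContinuousLinearMap.fst ℂ ℂ ℂ‖ ≤ 1 := ContinuousLinearMap.norm_fst_le ..
    have hg : ‖ContinuousLinearMap.snd ℂ ℂ ℂ‖ ≤ 1 := ContinuousLinearMap.norm_snd_le ..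
    refine (norm_add_le _ _).trans (add_le_add ?_ ?_)
    · rw [norm_smul, norm_mul, norm_pow, Complex.norm_natCast]
      calc _ ≤ (n : ℝ) ^ k * (M * Real.exp (-ε * n)) * 1 := by gcongr
        _ = _ := by ring
    · rw [norm_smul, norm_mul, norm_pow, Complex.norm_natCast]
      calc _ ≤ (n : ℝ) ^ (k + 1) * (M * Real.exp (-ε * n)) * 1 := by gcongr
        _ = _ := by ring

lemma contDiffOn_shiftSum (N : ℕ) {β : ℂ → ℂ} (h : IsDecaying β) (k : ℕ) :
    ContDiffOn ℂ N (shiftSum k β) {p | 0 < p.1.im ∧ 0 < p.2.im} := by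
  have hopen : IsOpen {p : ℂ × ℂ | 0 < p.1.im ∧ 0 < p.2.im} := by
    apply IsOpen.and
    · exact isOpen_lt continuous_const (by fun_prop)
    · exact isOpen_lt continuous_const (by fun_prop)
  induction N generalizing β k with
  | zero =>
    exact contDiffOn_zero.2 fun p hp =>
      (hasFDerivAt_shiftSum h k hp.1 hp.2).continuousAt.continuousWithinAt
  | succ N ih =>
    push_cast
    rw [contDiffOn_succ_iff_fderiv_of_isOpen hopen]
    refine ⟨fun p hp => (hasFDerivAt_shiftSum h k hp.1 hp.2).differentiableAt.differentiableWithinAt,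
      by simp, ?_⟩
    refine ContDiffOn.congr (f := fun p => shiftSum k (deriv β) p • ContinuousLinearMap.fst ℂ ℂ ℂ +
        shiftSum (k + 1) (deriv β) p • ContinuousLinearMap.snd ℂ ℂ ℂ) ?_
      fun p hp => (hasFDerivAt_shiftSum h k hp.1 hp.2).fderiv
    exact ((ih h.deriv k).smul contDiffOn_const).add ((ih h.deriv (k + 1)).smul contDiffOn_const)

end EllipticPVI

namespace EllipticPVI

open Filter Set ContDiff

/-! ### The quasi-periodic function `Z` -/

/-- The function `x / (1 - x)` of `x = exp (2 π i w)`. -/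
noncomputable def geom (w : ℂ) : ℂ :=
  Complex.exp (2 * Real.pi * Complex.I * w) / (1 - Complex.exp (2 * Real.pi * Complex.I * w))

lemma exp_eq_one_iff_int (w : ℂ) :
    Complex.exp (2 * Real.pi * Complex.I * w) = 1 ↔ ∃ m : ℤ, w = m := by
  rw [Complex.exp_eq_one_iff]
  refine exists_congr fun m => ?_
  have := Complex.two_pi_I_ne_zero
  constructor
  · intro h
    apply mul_left_cancel₀ this
    rw [h]; ring
  · rintro rfl
    ring

lemma contDiffAt_geom {w : ℂ} (hw : ∀ m : ℤ, w ≠ m) : ContDiffAt ℂ ∞ geom w := by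
  have : 1 - Complex.exp (2 * Real.pi * Complex.I * w) ≠ 0 := fun h => by
    obtain ⟨m, hm⟩ := (exp_eq_one_iff_int w).1 (sub_eq_zero.1 h).symm
    exact hw m hm
  unfold geom
  fun_prop (disch := assumption)

lemma ne_intCast_of_im_pos {w : ℂ} (hw : 0 < w.im) (m : ℤ) : w ≠ m := by
  rintro rfl
  simp at hw

lemma isDecaying_geom : IsDecaying geom := by
  refine ⟨fun w hw => ((contDiffAt_geom (ne_intCast_of_im_pos hw)).differentiableAt
    (by simp)).differentiableWithinAt, fun ε hε => ?_⟩
  have hnorm : ∀ w : ℂ, ‖Complex.exp (2 * Real.pi * Complex.I * w)‖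
      = Real.exp (-(2 * Real.pi * w.im)) := by
    intro w
    rw [Complex.norm_exp]
    congr 1
    simp
  have hpi := Real.pi_gt_three
  have hlt : Real.exp (-(2 * Real.pi * ε)) < 1 := by
    rw [Real.exp_lt_one_iff]
    nlinarith
  refine ⟨1 / (1 - Real.exp (-(2 * Real.pi * ε))), fun w hw => ?_⟩
  rw [geom, norm_div, hnorm, div_eq_mul_inv, one_div, mul_comm]
  have h1 : Real.exp (-(2 * Real.pi * w.im)) ≤ Real.exp (-(2 * Real.pi * ε)) := by
    gcongr
  have h2 : 1 - Real.exp (-(2 * Real.pi * ε)) ≤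
      ‖1 - Complex.exp (2 * Real.pi * Complex.I * w)‖ := by
    have := norm_sub_norm_le (1 : ℂ) (Complex.exp (2 * Real.pi * Complex.I * w))
    rw [hnorm, norm_one] at this
    linarith
  have h3 : Real.exp (-(2 * Real.pi * w.im)) ≤ Real.exp (-w.im) := by
    apply Real.exp_le_exp.2
    nlinarith
  gcongr

lemma geom_add_one (w : ℂ) : geom (w + 1) = geom w := by
  have : Complex.exp (2 * Real.pi * Complex.I * (w + 1)) =
      Complex.exp (2 * Real.pi * Complex.I * w) := by
    rw [mul_add, mul_one, Complex.exp_add, Complex.exp_two_pi_mul_I, mul_one]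
  rw [geom, this, geom]

lemma geom_add_geom_neg {w : ℂ} (hw : ∀ m : ℤ, w ≠ m) : geom w + geom (-w) = -1 := by
  have h1 : Complex.exp (2 * Real.pi * Complex.I * w) ≠ 1 := fun h => by
    obtain ⟨m, hm⟩ := (exp_eq_one_iff_int w).1 h
    exact hw m hm
  have h0 := Complex.exp_ne_zero (2 * Real.pi * Complex.I * w)
  rw [geom, geom, mul_neg, Complex.exp_neg]
  generalize Complex.exp (2 * Real.pi * Complex.I * w) = x at *
  have h2 : 1 - x ≠ 0 := sub_ne_zero.2 h1.symm
  have h3 : x - 1 ≠ 0 := sub_ne_zero.2 h1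
  have h4 : 1 - x⁻¹ = (x - 1) / x := by field_simp
  rw [h4]
  field_simp
  ring

/-- The sum of `geom (z + n τ)` over `n ≥ 0`. -/
noncomputable def halfSum (p : ℂ × ℂ) : ℂ := shiftSum 0 geom p

lemma halfSum_eq_add (z : ℂ) {τ : ℂ} (hτ : 0 < τ.im) :
    halfSum (z, τ) = geom z + halfSum (z + τ, τ) := by
  have h := (summable_shiftSum isDecaying_geom 0 z hτ).tsum_eq_zero_add
  simp only [halfSum, shiftSum] at *
  rw [h]
  simp only [pow_zero, one_mul, Nat.cast_zero, zero_mul, add_zero, Nat.cast_add, Nat.cast_one]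
  congr 1
  refine tsum_congr fun n => ?_
  congr 1
  ring

lemma halfSum_add_one (z τ : ℂ) : halfSum (z + 1, τ) = halfSum (z, τ) := by
  simp only [halfSum, shiftSum]
  refine tsum_congr fun n => ?_
  rw [show z + 1 + n * τ = z + n * τ + 1 by ring, geom_add_one]

/-- The series is already smooth for Im z > 0. Any other point is moved there by finitely many
shifts z ↦ z + τ, each splitting off one term `geom z` that is smooth away from the integers. -/
lemma contDiffAt_halfSum {z τ : ℂ} (hτ : 0 < τ.im) (h : ∀ n : ℕ, ∀ m : ℤ, z + n * τ ≠ m) :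
    ContDiffAt ℂ ∞ halfSum (z, τ) := by
  have key : ∀ k : ℕ, ∀ z : ℂ, (∀ n : ℕ, ∀ m : ℤ, z + n * τ ≠ m) → 0 < (z + k * τ).im →
      ContDiffAt ℂ ∞ halfSum (z, τ) := by
    intro k
    induction k with
    | zero =>
      intro z _ hz
      have hopen : IsOpen {p : ℂ × ℂ | 0 < p.1.im ∧ 0 < p.2.im} := by
        apply IsOpen.and
        · exact isOpen_lt continuous_const (by fun_prop)
        · exact isOpen_lt continuous_const (by fun_prop)
      have : ContDiffOn ℂ ∞ halfSum {p : ℂ × ℂ | 0 < p.1.im ∧ 0 < p.2.im} :=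
        contDiffOn_infty.2 fun N => contDiffOn_shiftSum N isDecaying_geom 0
      exact this.contDiffAt (hopen.mem_nhds ⟨by simpa using hz, hτ⟩)
    | succ k ih =>
      intro z hz hk
      have h1 : ContDiffAt ℂ ∞ halfSum (z + τ, τ) := by
        refine ih (z + τ) (fun n m => ?_) ?_
        · have := hz (n + 1) m
          push_cast at this
          rwa [show z + τ + n * τ = z + (n + 1) * τ by ring]
        · push_cast at hk
          rwa [show z + τ + k * τ = z + (k + 1) * τ by ring]
      have h2 : ContDiffAt ℂ ∞ (fun p : ℂ × ℂ => geom p.1 + halfSum (p.1 + p.2, p.2)) (z, τ) := by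
        refine ContDiffAt.add ?_ ?_
        · have : ContDiffAt ℂ ∞ geom z := contDiffAt_geom fun m => by simpa using hz 0 m
          exact this.comp (z, τ) contDiffAt_fst
        · exact ContDiffAt.comp (z, τ) (f := fun p : ℂ × ℂ => (p.1 + p.2, p.2)) h1 (by fun_prop)
      refine h2.congr_of_eventuallyEq ?_
      have : ∀ᶠ p : ℂ × ℂ in 𝓝 (z, τ), 0 < p.2.im :=
        (isOpen_lt continuous_const (by fun_prop : Continuous fun p : ℂ × ℂ => p.2.im)).mem_nhds hτ
      filter_upwards [this] with p hp
      exact halfSum_eq_add p.1 hp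
  obtain ⟨k, hk⟩ : ∃ k : ℕ, -z.im / τ.im < k := exists_nat_gt _
  refine key k z h ?_
  rw [div_lt_iff₀ hτ] at hk
  simp
  linarith

/-- The logarithmic derivative (in the first variable) of the odd theta function: it has period `1`,
changes by `-2 π i` under `z ↦ z + τ`, and has residue `1` at lattice points. -/
noncomputable def zeta (p : ℂ × ℂ) : ℂ :=
  -(Real.pi * Complex.I) -
    2 * Real.pi * Complex.I * (halfSum p - halfSum (p.2 - p.1, p.2))

/-- The pairs `(z, τ)` with `τ` in the upper half-plane and `z` not in the lattice `ℤ + ℤ τ`. -/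
def offLattice : Set (ℂ × ℂ) := {p | 0 < p.2.im ∧ ∀ m n : ℤ, p.1 ≠ m + n * p.2}

/-- In the real coordinates (x, y) of z = x + yτ, which depend continuously on (z, τ), the lattice
is the fixed closed set ℤ × ℤ. -/
lemma isOpen_offLattice : IsOpen offLattice := by
  let u : ℂ × ℂ → ℝ × ℝ := fun p => (p.1.re - p.1.im / p.2.im * p.2.re, p.1.im / p.2.im)
  let K : Set (ℝ × ℝ) := range ((↑) : ℤ → ℝ) ×ˢ range ((↑) : ℤ → ℝ)
  have hK : IsClosed K :=
    Int.isClosedEmbedding_coe_real.isClosed_range.prod Int.isClosedEmbedding_coe_real.isClosed_range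
  have hopen : IsOpen {p : ℂ × ℂ | 0 < p.2.im} := isOpen_lt continuous_const (by fun_prop)
  have hu : ContinuousOn u {p : ℂ × ℂ | 0 < p.2.im} := by
    have : ∀ p ∈ {p : ℂ × ℂ | 0 < p.2.im}, p.2.im ≠ 0 := fun p hp => ne_of_gt hp
    have h2 : ContinuousOn (fun p : ℂ × ℂ => p.1.im / p.2.im) {p : ℂ × ℂ | 0 < p.2.im} :=
      ContinuousOn.div (by fun_prop) (by fun_prop) this
    exact (ContinuousOn.sub (by fun_prop) (h2.mul (by fun_prop))).prodMk h2
  have : offLattice = {p : ℂ × ℂ | 0 < p.2.im} ∩ u ⁻¹' Kᶜ := by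
    ext ⟨z, τ⟩
    simp only [offLattice, mem_ofPred_eq, mem_inter_iff, mem_preimage, mem_compl_iff]
    refine and_congr_right fun hτ => ?_
    constructor
    · rintro h ⟨⟨m, hm⟩, ⟨n, hn⟩⟩
      simp only [u] at hm hn
      rw [← hn] at hm
      refine h m n (Complex.ext ?_ ?_)
      · simp; linarith
      · rw [eq_div_iff hτ.ne'] at hn
        simp [hn]
    · rintro h m n rfl
      apply h
      have : (n : ℝ) * τ.im / τ.im = n := by field_simp
      refine ⟨⟨m, ?_⟩, ⟨n, ?_⟩⟩
      · simp [u, this]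
      · simp [u, this]
  rw [this]
  exact hu.isOpen_inter_preimage hopen hK.isOpen_compl

lemma offLattice_ne_int {z τ : ℂ} (h : (z, τ) ∈ offLattice) (m : ℤ) : z ≠ m := by
  simpa using h.2 m 0

lemma contDiffAt_zeta {p : ℂ × ℂ} (h : p ∈ offLattice) : ContDiffAt ℂ ∞ zeta p := by
  obtain ⟨z, τ⟩ := p
  unfold zeta
  have h1 : ContDiffAt ℂ ∞ halfSum (z, τ) := contDiffAt_halfSum h.1 fun n m hm =>
    h.2 m (-n) (by push_cast; rw [← hm]; ring)
  have h2 : ContDiffAt ℂ ∞ halfSum (τ - z, τ) := contDiffAt_halfSum h.1 fun n m hm =>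
    h.2 (-m) (n + 1) (by push_cast; rw [← hm]; ring)
  have h3 := ContDiffAt.comp (z, τ) (f := fun p : ℂ × ℂ => (p.2 - p.1, p.2)) h2 (by fun_prop)
  exact contDiffAt_const.sub (contDiffAt_const.mul (h1.sub h3))

lemma zeta_add_one (z : ℂ) (τ : ℂ) : zeta (z + 1, τ) = zeta (z, τ) := by
  simp only [zeta]
  rw [halfSum_add_one, ← halfSum_add_one (τ - (z + 1)), show τ - (z + 1) + 1 = τ - z by ring]

/-- The shift moves one term across each half sum, and geom z + geom(-z) = -1 turns the exchange
into -2πi. -/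
lemma zeta_add_tau {z τ : ℂ} (h : (z, τ) ∈ offLattice) :
    zeta (z + τ, τ) = zeta (z, τ) - 2 * Real.pi * Complex.I := by
  have h1 := halfSum_eq_add z h.1
  have h2 := halfSum_eq_add (-z) h.1
  have h3 := geom_add_geom_neg (offLattice_ne_int h)
  simp only [zeta]
  rw [show τ - (z + τ) = -z by ring, h1, h2, show -z + τ = τ - z by ring]
  linear_combination (2 * Real.pi * Complex.I) * h3

/-- The constant -πi in `zeta` is the one that makes the function odd. -/
lemma zeta_neg {z τ : ℂ} (h : (z, τ) ∈ offLattice) : zeta (-z, τ) = -zeta (z, τ) := by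
  have h1 := halfSum_eq_add z h.1
  have h2 := halfSum_eq_add (-z) h.1
  have h3 := geom_add_geom_neg (offLattice_ne_int h)
  simp only [zeta]
  rw [show τ - -z = z + τ by ring, h1, h2, show -z + τ = τ - z by ring]
  linear_combination (-(2 * Real.pi * Complex.I)) * h3

/-- Factorization of an analytic function vanishing at a point. -/
lemma exists_analyticAt_eq_mul {f : ℂ → ℂ} (hf : AnalyticAt ℂ f 0) (h0 : f 0 = 0) :
    ∃ g : ℂ → ℂ, AnalyticAt ℂ g 0 ∧ g 0 = deriv f 0 ∧ ∀ z, f z = z * g z := by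
  obtain ⟨q, hq⟩ := hf
  refine ⟨dslope f 0, hq.has_fpower_series_dslope_fslope.analyticAt, by simp, fun z => ?_⟩
  have := sub_smul_dslope f 0 z
  rw [h0] at this
  simpa using this.symm

lemma exists_analyticAt_geom :
    ∃ g : ℂ → ℂ, AnalyticAt ℂ g 0 ∧
      ∀ᶠ z in 𝓝 (0 : ℂ), z ≠ 0 → -(2 * Real.pi * Complex.I) * geom z = 1 / z + g z := by
  have hE : AnalyticAt ℂ (fun z => Complex.exp (2 * Real.pi * Complex.I * z)) 0 := by fun_prop
  have hEd : deriv (fun z => Complex.exp (2 * Real.pi * Complex.I * z) - 1) 0 =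
      2 * Real.pi * Complex.I := by
    have : HasDerivAt (fun z : ℂ => Complex.exp (2 * Real.pi * Complex.I * z) - 1)
        (Complex.exp (2 * Real.pi * Complex.I * 0) * (2 * Real.pi * Complex.I * 1)) 0 :=
      (((hasDerivAt_id (0 : ℂ)).const_mul (2 * Real.pi * Complex.I)).cexp).sub_const 1
    rw [this.deriv]
    simp
  obtain ⟨φ, hφ, hφ0, hφe⟩ := exists_analyticAt_eq_mul (hE.sub analyticAt_const) (f :=
    fun z => Complex.exp (2 * Real.pi * Complex.I * z) - 1) (by simp)
  rw [hEd] at hφ0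
  have hφne : φ 0 ≠ 0 := hφ0 ▸ Complex.two_pi_I_ne_zero
  -- With exp(2πiz) - 1 = zφ, subtracting 1/z from -2πi geom z leaves (2πi exp(2πiz) - φ)/(zφ). Its
  -- numerator vanishes at 0 and so absorbs the factor z.
  obtain ⟨ψ, hψ, -, hψe⟩ := exists_analyticAt_eq_mul
    (f := fun z => 2 * Real.pi * Complex.I * Complex.exp (2 * Real.pi * Complex.I * z) - φ z)
    ((analyticAt_const.mul hE).sub hφ) (by simp [hφ0])
  refine ⟨fun z => ψ z / φ z, hψ.div hφ hφne, ?_⟩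
  filter_upwards [hφ.continuousAt.eventually_ne hφne] with z hz hz0
  have h1 := hφe z
  have h2 := hψe z
  rw [geom]
  generalize Complex.exp (2 * Real.pi * Complex.I * z) = x at *
  have h3 : 1 - x = -(z * φ z) := by rw [← h1]; ring
  rw [h3]
  field_simp
  linear_combination h2

/-- `zeta` has a simple pole with residue `1` at the origin, uniformly in `τ`. -/
lemma exists_zeta_eq_inv_add {τ : ℂ} (hτ : 0 < τ.im) :
    ∃ R : ℂ × ℂ → ℂ, ContDiffAt ℂ ∞ R (0, τ) ∧
      ∀ᶠ p in 𝓝 ((0 : ℂ), τ), p.1 ≠ 0 → zeta p = 1 / p.1 + R p := by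
  obtain ⟨g, hg, hge⟩ := exists_analyticAt_geom
  have aux : ∀ n : ℕ, ∀ m : ℤ, τ + n * τ ≠ m := fun n m h => by
    have := congrArg Complex.im h
    simp at this
    have : 0 < τ.im + n * τ.im := by positivity
    linarith
  have h0 : ContDiffAt ℂ ∞ halfSum (τ, τ) := contDiffAt_halfSum hτ aux
  -- Only the n = 0 term of the first half sum is singular at z = 0; it is replaced by its regular
  -- part g, which does not depend on τ.
  refine ⟨fun p => -(Real.pi * Complex.I) + g p.1 -
    2 * Real.pi * Complex.I * (halfSum (p.1 + p.2, p.2) - halfSum (p.2 - p.1, p.2)), ?_, ?_⟩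
  · have h1 : ContDiffAt ℂ ∞ (fun p : ℂ × ℂ => halfSum (p.1 + p.2, p.2)) (0, τ) :=
      ContDiffAt.comp (0, τ) (g := halfSum) (f := fun p : ℂ × ℂ => (p.1 + p.2, p.2)) (by simpa using h0)
        (by fun_prop)
    have h2 : ContDiffAt ℂ ∞ (fun p : ℂ × ℂ => halfSum (p.2 - p.1, p.2)) (0, τ) :=
      ContDiffAt.comp (0, τ) (g := halfSum) (f := fun p : ℂ × ℂ => (p.2 - p.1, p.2)) (by simpa using h0)
        (by fun_prop)
    have h3 : ContDiffAt ℂ ∞ (fun p : ℂ × ℂ => g p.1) (0, τ) :=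
      ContDiffAt.comp (0, τ) (g := g) hg.contDiffAt contDiffAt_fst
    exact (contDiffAt_const.add h3).sub (contDiffAt_const.mul (h1.sub h2))
  · have hτ' : ∀ᶠ p : ℂ × ℂ in 𝓝 (0, τ), 0 < p.2.im :=
      (isOpen_lt continuous_const (by fun_prop : Continuous fun p : ℂ × ℂ => p.2.im)).mem_nhds hτ
    have hg' : ∀ᶠ p : ℂ × ℂ in 𝓝 (0, τ), p.1 ≠ 0 →
        -(2 * Real.pi * Complex.I) * geom p.1 = 1 / p.1 + g p.1 :=
      (continuous_fst.tendsto ((0 : ℂ), τ)).eventually hge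
    filter_upwards [hτ', hg'] with p hp1 hp2 hp
    simp only [zeta]
    rw [show p = (p.1, p.2) from rfl, halfSum_eq_add p.1 hp1]
    linear_combination hp2 hp

end EllipticPVI

namespace EllipticPVI

open Filter Set ContDiff

/-! ### Liouville's theorem for elliptic functions -/

lemma limUnder_eq_of_eventuallyEq {f g : ℂ → ℂ} {z : ℂ} (hg : ContinuousAt g z)
    (h : f =ᶠ[𝓝[≠] z] g) : limUnder (𝓝[≠] z) f = g z :=
  ((hg.tendsto.mono_left nhdsWithin_le_nhds).congr' h.symm).limUnder_eq

lemma map_add_right_nhdsNE (z w : ℂ) : map (· + w) (𝓝[≠] z) = 𝓝[≠] (z + w) :=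
  (Homeomorph.addRight w).isEmbedding.map_nhdsWithin_eq {z}ᶜ z |>.trans <| by
    congr 1
    ext y
    simp [← sub_eq_iff_eq_add]

lemma eventually_nhdsNE_add {p : ℂ → Prop} {z : ℂ} (w : ℂ) (h : ∀ᶠ y in 𝓝[≠] (z + w), p y) :
    ∀ᶠ y in 𝓝[≠] z, p (y + w) := by
  rw [← map_add_right_nhdsNE] at h
  exact h

/-- A function has a removable singularity at `z`. -/
def Removable (f : ℂ → ℂ) (z : ℂ) : Prop := ∃ g, AnalyticAt ℂ g z ∧ f =ᶠ[𝓝[≠] z] g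

lemma Removable.of_add {f : ℂ → ℂ} {z w : ℂ} (h : Removable f (z + w))
    (hf : ∀ᶠ y in 𝓝[≠] z, f (y + w) = f y) : Removable f z := by
  obtain ⟨g, hg, hfg⟩ := h
  refine ⟨fun y => g (y + w), hg.fun_comp (f := fun y => y + w) (by fun_prop), ?_⟩
  filter_upwards [eventually_nhdsNE_add w hfg, hf] with y h1 h2
  rw [← h2, h1]

/-- Punctured neighbourhoods are used throughout because the values of f at its singular points
carry no information. Extending f by its limits gives an entire periodic function, bounded by
compactness, so Liouville's theorem applies. -/
lemma exists_const_of_elliptic (L : PeriodPair) {f : ℂ → ℂ}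
    (hper : ∀ z, ∀ w ∈ L.lattice, ∀ᶠ y in 𝓝[≠] z, f (y + w) = f y)
    (hrem : ∀ z, Removable f z) :
    ∃ c, ∀ z, f =ᶠ[𝓝[≠] z] fun _ => c := by
  let F : ℂ → ℂ := fun z => limUnder (𝓝[≠] z) f
  have hF : ∀ z, ∃ g, AnalyticAt ℂ g z ∧ f =ᶠ[𝓝[≠] z] g ∧ F =ᶠ[𝓝 z] g := by
    intro z
    obtain ⟨g, hg, hfg⟩ := hrem z
    refine ⟨g, hg, hfg, ?_⟩
    have h1 : ∀ᶠ w in 𝓝 z, w ≠ z → ∀ᶠ y in 𝓝 w, f y = g y := by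
      have := eventually_eventually_nhdsWithin.2 hfg
      rw [eventually_nhdsWithin_iff] at this
      filter_upwards [this] with w hw hwz
      have h2 := hw hwz
      rwa [IsOpen.nhdsWithin_eq isOpen_compl_singleton hwz] at h2
    filter_upwards [h1, hg.eventually_analyticAt] with w hw hgw
    by_cases hwz : w = z
    · subst hwz
      exact limUnder_eq_of_eventuallyEq hg.continuousAt hfg
    · exact limUnder_eq_of_eventuallyEq hgw.continuousAt ((hw hwz).filter_mono nhdsWithin_le_nhds)
  have hdiff : Differentiable ℂ F := fun z => by
    obtain ⟨g, hg, -, h⟩ := hF z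
    exact (hg.congr h.symm).differentiableAt
  have hFper : ∀ z w, w ∈ L.lattice → F (z + w) = F z := by
    intro z w hw
    obtain ⟨g, hg, h1, h2⟩ := hF (z + w)
    have hg' : ContinuousAt (fun y => g (y + w)) z :=
      ContinuousAt.comp (f := fun y => y + w) hg.continuousAt (by fun_prop)
    have : F z = g (z + w) := by
      refine limUnder_eq_of_eventuallyEq hg' ?_
      filter_upwards [eventually_nhdsNE_add w h1, hper z w hw] with y h1 h2
      rw [← h2, h1]
    rw [this, h2.eq_of_nhds]
  have hbd := (IsZLattice.isCompact_range_of_periodic L.lattice F hdiff.continuous hFper).isBounded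
  refine ⟨F 0, fun z => ?_⟩
  obtain ⟨g, hg, h1, h2⟩ := hF z
  filter_upwards [h1, h2.filter_mono nhdsWithin_le_nhds] with y h3 h4
  rw [h3, ← h4]
  exact hdiff.apply_eq_apply_of_bounded hbd y 0

lemma eq_of_continuousAt_of_eventuallyEq_const {f : ℂ → ℂ} {c z : ℂ} (hf : ContinuousAt f z)
    (h : f =ᶠ[𝓝[≠] z] fun _ => c) : f z = c :=
  tendsto_nhds_unique (hf.tendsto.mono_left nhdsWithin_le_nhds)
    (tendsto_const_nhds.congr' h.symm)

/-! ### Values and poles of ℘ for a fixed lattice. -/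

section Lattice

variable (L : PeriodPair)

lemma eventually_nhds_notMem {z : ℂ} (hz : z ∉ L.lattice) : ∀ᶠ y in 𝓝 z, y ∉ L.lattice :=
  L.isClosed_lattice.isOpen_compl.mem_nhds hz

lemma eventually_nhdsNE_notMem (z : ℂ) : ∀ᶠ y in 𝓝[≠] z, y ∉ L.lattice := by
  have := L.compl_lattice_sdiff_singleton_mem_nhds z
  rw [eventually_nhdsWithin_iff]
  filter_upwards [this] with y hy hyz hyL
  exact hy ⟨hyL, hyz⟩

lemma add_mem_lattice_iff {z w : ℂ} (hw : w ∈ L.lattice) : z + w ∈ L.lattice ↔ z ∈ L.lattice :=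
  L.lattice.add_mem_iff_left hw

lemma countable_lattice : (L.lattice : Set ℂ).Countable := by
  have : Countable L.lattice := L.latticeEquivProd.toEquiv.countable_iff.2 inferInstance
  exact this

lemma analyticAt_weierstrassP {z : ℂ} (hz : z ∉ L.lattice) : AnalyticAt ℂ L.weierstrassP z :=
  L.analyticOnNhd_weierstrassP z hz

lemma analyticAt_derivWeierstrassP {z : ℂ} (hz : z ∉ L.lattice) :
    AnalyticAt ℂ L.derivWeierstrassP z :=
  L.analyticOnNhd_derivWeierstrassP z hz

lemma hasDerivAt_weierstrassP {z : ℂ} (hz : z ∉ L.lattice) :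
    HasDerivAt L.weierstrassP (L.derivWeierstrassP z) z := by
  have := (analyticAt_weierstrassP L hz).differentiableAt.hasDerivAt
  rwa [L.deriv_weierstrassP] at this

lemma weierstrassP_add {w : ℂ} (z : ℂ) (hw : w ∈ L.lattice) :
    L.weierstrassP (z + w) = L.weierstrassP z := L.weierstrassP_add_coe z ⟨w, hw⟩

lemma derivWeierstrassP_add {w : ℂ} (z : ℂ) (hw : w ∈ L.lattice) :
    L.derivWeierstrassP (z + w) = L.derivWeierstrassP z := L.derivWeierstrassP_add_coe z ⟨w, hw⟩

/-- The regular part of `℘` at the origin. -/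
lemma exists_weierstrassP_eq : ∃ E : ℂ → ℂ, AnalyticAt ℂ E 0 ∧
    ∀ z, L.weierstrassP z = E z + 1 / z ^ 2 := by
  refine ⟨L.weierstrassPExcept 0, L.analyticAt_weierstrassPExcept 0, fun z => ?_⟩
  have := L.weierstrassPExcept_add 0 z
  simpa using this.symm

lemma not_eventually_weierstrassP_eq_const (c : ℂ) :
    ¬ ∀ᶠ z in 𝓝[≠] (0 : ℂ), L.weierstrassP z = c := by
  intro h
  obtain ⟨E, hE, hEe⟩ := exists_weierstrassP_eq L
  have h1 : Tendsto (fun z : ℂ => z ^ 2 * (c - E z)) (𝓝[≠] 0) (𝓝 (0 ^ 2 * (c - E 0))) := by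
    refine Tendsto.mono_left ?_ nhdsWithin_le_nhds
    have : ContinuousAt (fun z : ℂ => z ^ 2 * (c - E z)) 0 := by
      have := hE.continuousAt
      fun_prop
    exact this.tendsto
  have h2 : (fun z : ℂ => z ^ 2 * (c - E z)) =ᶠ[𝓝[≠] 0] fun _ => 1 := by
    filter_upwards [h, self_mem_nhdsWithin] with z hz hz0
    have hz0' : z ≠ 0 := hz0
    rw [← hz, hEe]
    field_simp
    ring
  have := tendsto_nhds_unique (h1.congr' h2) tendsto_const_nhds
  simp at this

/-- Otherwise 1/(℘ - c) would be elliptic without poles, hence constant; it tends to 0 at the double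
pole of ℘, so it would vanish identically, which is absurd. -/
lemma exists_weierstrassP_eq_const (c : ℂ) : ∃ z, z ∉ L.lattice ∧ L.weierstrassP z = c := by
  by_contra! hne
  obtain ⟨E, hE, hEe⟩ := exists_weierstrassP_eq L
  have h0 : AnalyticAt ℂ (fun z : ℂ => z ^ 2 / (1 + z ^ 2 * (E z - c))) 0 := by
    refine AnalyticAt.div (by fun_prop) (by fun_prop) (by simp)
  have h0e : (fun z => (L.weierstrassP z - c)⁻¹) =ᶠ[𝓝[≠] 0]
      fun z : ℂ => z ^ 2 / (1 + z ^ 2 * (E z - c)) := by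
    filter_upwards [self_mem_nhdsWithin] with z hz
    have hz' : z ≠ 0 := hz
    rw [hEe, show E z + 1 / z ^ 2 - c = (1 + z ^ 2 * (E z - c)) / z ^ 2 by field_simp; ring,
      inv_div]
  have hper : ∀ w ∈ L.lattice, ∀ z, (L.weierstrassP (z + w) - c)⁻¹ = (L.weierstrassP z - c)⁻¹ :=
    fun w hw z => by rw [weierstrassP_add L z hw]
  obtain ⟨k, hk⟩ := exists_const_of_elliptic L (f := fun z => (L.weierstrassP z - c)⁻¹)
    (fun z w hw => .of_forall fun y => hper w hw y) (fun z => by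
      by_cases hz : z ∈ L.lattice
      · refine Removable.of_add (w := -z) ?_ (.of_forall fun y => hper _ (neg_mem hz) y)
        rw [add_neg_cancel]
        exact ⟨_, h0, h0e⟩
      · exact ⟨_, ((analyticAt_weierstrassP L hz).sub analyticAt_const).inv
          (sub_ne_zero.2 (hne z hz)), .rfl⟩)
  have h1 : (0 : ℂ) ^ 2 / (1 + 0 ^ 2 * (E 0 - c)) = k :=
    eq_of_continuousAt_of_eventuallyEq_const (f := fun z : ℂ => z ^ 2 / (1 + z ^ 2 * (E z - c)))
      h0.continuousAt (h0e.symm.trans (hk 0))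
  obtain ⟨z, hz, hzL⟩ := ((hk 0).and (eventually_nhdsNE_notMem L 0)).exists
  have h2 : (L.weierstrassP z - c)⁻¹ = 0 := by
    simp only [← h1] at hz
    simpa using hz
  exact hne z hzL (sub_eq_zero.1 (inv_eq_zero.1 h2))

/-! ### Half-periods -/

/-- Representatives of the three nonzero half-periods. -/
structure IsHalfPeriods (h₁ h₂ h₃ : ℂ) : Prop where
  notMem₁ : h₁ ∉ L.lattice
  notMem₂ : h₂ ∉ L.lattice
  notMem₃ : h₃ ∉ L.lattice
  two₁ : h₁ + h₁ ∈ L.lattice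
  two₂ : h₂ + h₂ ∈ L.lattice
  two₃ : h₃ + h₃ ∈ L.lattice
  sum : h₁ + h₂ + h₃ ∈ L.lattice

variable {L} {h₁ h₂ h₃ : ℂ}

lemma IsHalfPeriods.rotate (h : IsHalfPeriods L h₁ h₂ h₃) : IsHalfPeriods L h₂ h₃ h₁ :=
  ⟨h.notMem₂, h.notMem₃, h.notMem₁, h.two₂, h.two₃, h.two₁, by
    rw [show h₂ + h₃ + h₁ = h₁ + h₂ + h₃ by ring]; exact h.sum⟩

lemma derivWeierstrassP_half {h : ℂ} (hh : h + h ∈ L.lattice) : L.derivWeierstrassP h = 0 := by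
  have h1 := derivWeierstrassP_add L (-h) hh
  rw [neg_add_cancel_left, L.derivWeierstrassP_neg] at h1
  exact CharZero.eq_neg_self_iff.1 h1

lemma IsHalfPeriods.weierstrassP_add₁₂ (h : IsHalfPeriods L h₁ h₂ h₃) :
    L.weierstrassP (h₂ + h₁) = L.weierstrassP h₃ := by
  rw [← L.weierstrassP_neg h₃, show h₂ + h₁ = -h₃ + (h₁ + h₂ + h₃) by ring, weierstrassP_add L _ h.sum]

lemma IsHalfPeriods.add_notMem (h : IsHalfPeriods L h₁ h₂ h₃) : h₂ + h₁ ∉ L.lattice := by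
  intro h1
  have := L.lattice.sub_mem h.sum h1
  rw [show h₁ + h₂ + h₃ - (h₂ + h₁) = h₃ by ring] at this
  exact h.notMem₃ this

/-- The double pole of the first factor meets a zero of order at least two of the second, since
℘'(h) = 0. -/
lemma removable_half_mul {h : ℂ} (hh : h ∉ L.lattice) (hh2 : h + h ∈ L.lattice) :
    Removable (fun z => (L.weierstrassP z - L.weierstrassP h) *
      (L.weierstrassP (z + h) - L.weierstrassP h)) 0 := by
  obtain ⟨E, hE, hEe⟩ := exists_weierstrassP_eq L
  have hP : AnalyticAt ℂ (fun z => L.weierstrassP (z + h) - L.weierstrassP h) 0 := by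
    refine AnalyticAt.sub (AnalyticAt.fun_comp (g := L.weierstrassP) ?_ (by fun_prop)) analyticAt_const
    simpa using analyticAt_weierstrassP L hh
  have hPd : deriv (fun z => L.weierstrassP (z + h) - L.weierstrassP h) 0 = 0 := by
    have := (hasDerivAt_weierstrassP L (z := 0 + h) (by simpa using hh)).comp_add_const 0 h
    rw [zero_add, derivWeierstrassP_half hh2] at this
    exact (this.sub_const _).deriv
  obtain ⟨k, hk, hk0, hke⟩ := exists_analyticAt_eq_mul hP (by simp)
  rw [hPd] at hk0
  obtain ⟨l, hl, -, hle⟩ := exists_analyticAt_eq_mul hk hk0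
  refine ⟨fun z => (z ^ 2 * (E z - L.weierstrassP h) + 1) * l z, by fun_prop, ?_⟩
  filter_upwards [self_mem_nhdsWithin] with z hz
  have hz' : z ≠ 0 := hz
  have h1 := hke z
  rw [h1, hle, hEe]
  field_simp
  ring

/-- The product is elliptic and invariant under z ↦ z + h₁, which carries the possible poles at -h₁
+ Λ to lattice points, where they are removable. The constant is read off at z = h₂, where ℘(h₂ +
h₁) = ℘(h₃). -/
lemma IsHalfPeriods.mul_eq (h : IsHalfPeriods L h₁ h₂ h₃) {z : ℂ} (hz : z ∉ L.lattice)
    (hz' : z + h₁ ∉ L.lattice) :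
    (L.weierstrassP z - L.weierstrassP h₁) * (L.weierstrassP (z + h₁) - L.weierstrassP h₁) =
      (L.weierstrassP h₂ - L.weierstrassP h₁) * (L.weierstrassP h₃ - L.weierstrassP h₁) := by
  set f : ℂ → ℂ := fun z => (L.weierstrassP z - L.weierstrassP h₁) *
      (L.weierstrassP (z + h₁) - L.weierstrassP h₁) with hf
  have hper : ∀ w ∈ L.lattice, ∀ z, f (z + w) = f z := by
    intro w hw z
    simp only [hf]
    rw [show z + w + h₁ = z + h₁ + w by ring, weierstrassP_add L _ hw, weierstrassP_add L _ hw]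
  have hper' : ∀ z, f (z + h₁) = f z := by
    intro z
    simp only [hf]
    rw [show z + h₁ + h₁ = z + (h₁ + h₁) by ring, weierstrassP_add L _ h.two₁, mul_comm]
  have hlat : ∀ z ∈ L.lattice, Removable f z := fun z hz => by
    refine Removable.of_add (w := -z) ?_ (.of_forall fun y => hper _ (neg_mem hz) y)
    rw [add_neg_cancel]
    exact removable_half_mul h.notMem₁ h.two₁
  have han : ∀ z, z ∉ L.lattice → z + h₁ ∉ L.lattice → AnalyticAt ℂ f z := fun z hz hz' =>
    ((analyticAt_weierstrassP L hz).sub analyticAt_const).mul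
      ((AnalyticAt.fun_comp (g := L.weierstrassP) (f := fun z => z + h₁)
        (analyticAt_weierstrassP L hz') (by fun_prop)).sub analyticAt_const)
  obtain ⟨c, hc⟩ := exists_const_of_elliptic L (f := f)
    (fun z w hw => .of_forall fun y => hper w hw y) (fun z => by
      by_cases hz : z ∈ L.lattice
      · exact hlat z hz
      by_cases hz' : z + h₁ ∈ L.lattice
      · exact (hlat _ hz').of_add (.of_forall hper')
      · exact ⟨f, han z hz hz', .rfl⟩)
  have h1 := eq_of_continuousAt_of_eventuallyEq_const (han z hz hz').continuousAt (hc z)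
  have h2 := eq_of_continuousAt_of_eventuallyEq_const
    (han h₂ h.notMem₂ h.add_notMem).continuousAt (hc h₂)
  simp only [hf] at h1 h2
  rw [h1, ← h2, h.weierstrassP_add₁₂]

/-- If the values agreed, the product in `mul_eq` would vanish identically. On a connected domain
one factor would then vanish, making ℘ constant despite its pole. -/
lemma IsHalfPeriods.weierstrassP_ne (h : IsHalfPeriods L h₁ h₂ h₃) :
    L.weierstrassP h₂ ≠ L.weierstrassP h₁ := by
  intro heq
  have hshift : ((fun z => z + h₁) ⁻¹' (L.lattice : Set ℂ)).Countable :=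
    (countable_lattice L).preimage (add_left_injective h₁)
  let U : Set ℂ := ((L.lattice : Set ℂ) ∪ (fun z => z + h₁) ⁻¹' (L.lattice : Set ℂ))ᶜ
  have hU : IsPreconnected U :=
    (((countable_lattice L).union hshift).isPathConnected_compl_of_one_lt_rank
      (by simp)).isConnected.isPreconnected
  have hzero : ∀ z ∈ U, (L.weierstrassP z - L.weierstrassP h₁) *
      (L.weierstrassP (z + h₁) - L.weierstrassP h₁) = 0 := by
    intro z hz
    simp only [U, mem_compl_iff, mem_union, not_or] at hz
    rw [h.mul_eq hz.1 hz.2, heq, sub_self, zero_mul]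
  have hP : ∀ z, z ∉ L.lattice → z + h₁ ∉ L.lattice → L.weierstrassP z = L.weierstrassP h₁ := by
    have a1 : AnalyticOnNhd ℂ (fun z => L.weierstrassP z - L.weierstrassP h₁) U := fun z hz => by
      simp only [U, mem_compl_iff, mem_union, not_or] at hz
      exact (analyticAt_weierstrassP L hz.1).sub analyticAt_const
    have a2 : AnalyticOnNhd ℂ (fun z => L.weierstrassP (z + h₁) - L.weierstrassP h₁) U :=
      fun z hz => by
        simp only [U, mem_compl_iff, mem_union, not_or] at hz
        exact (AnalyticAt.fun_comp (g := L.weierstrassP) (f := fun z => z + h₁)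
          (analyticAt_weierstrassP L hz.2) (by fun_prop)).sub analyticAt_const
    rcases a1.eq_zero_or_eq_zero_of_mul_eq_zero a2 hzero hU with h1 | h1
    · intro z hz hz'
      exact sub_eq_zero.1 (h1 z (by simp only [U, mem_compl_iff, mem_union, not_or]; exact ⟨hz, hz'⟩))
    · intro z hz hz'
      have := h1 (z + h₁) (by
        simp only [U, mem_compl_iff, mem_union, not_or]
        refine ⟨hz', ?_⟩
        show z + h₁ + h₁ ∉ L.lattice
        rw [add_assoc, add_mem_lattice_iff L h.two₁]
        exact hz)
      rw [add_assoc, weierstrassP_add L _ h.two₁] at this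
      exact sub_eq_zero.1 this
  refine not_eventually_weierstrassP_eq_const L (L.weierstrassP h₁) ?_
  filter_upwards [eventually_nhdsNE_notMem L 0,
    eventually_nhdsNE_add h₁ (eventually_nhdsNE_notMem L (0 + h₁))] with z hz hz'
  exact hP z hz hz'

/-- The three values ℘(hᵢ) are distinct roots of the cubic 4x³ - g₂x - g₃, so they factor it. -/
lemma IsHalfPeriods.derivWeierstrassP_sq (h : IsHalfPeriods L h₁ h₂ h₃) {z : ℂ}
    (hz : z ∉ L.lattice) :
    L.derivWeierstrassP z ^ 2 = 4 * ((L.weierstrassP z - L.weierstrassP h₁) *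
      (L.weierstrassP z - L.weierstrassP h₂) * (L.weierstrassP z - L.weierstrassP h₃)) := by
  have r1 := L.derivWeierstrassP_sq h₁ h.notMem₁
  have r2 := L.derivWeierstrassP_sq h₂ h.notMem₂
  have r3 := L.derivWeierstrassP_sq h₃ h.notMem₃
  rw [derivWeierstrassP_half h.two₁] at r1
  rw [derivWeierstrassP_half h.two₂] at r2
  rw [derivWeierstrassP_half h.two₃] at r3
  have n12 := sub_ne_zero.2 h.weierstrassP_ne
  have n23 := sub_ne_zero.2 h.rotate.weierstrassP_ne
  have n31 := sub_ne_zero.2 h.rotate.rotate.weierstrassP_ne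
  rw [L.derivWeierstrassP_sq z hz]
  generalize L.weierstrassP z = x at *
  generalize L.weierstrassP h₁ = a at *
  generalize L.weierstrassP h₂ = b at *
  generalize L.weierstrassP h₃ = c at *
  generalize L.g₂ = g at *
  generalize L.g₃ = k at *
  -- Divided differences of the cubic at its roots; a second round gives a + b + c = 0.
  have s1 : 4 * (a ^ 2 + a * b + b ^ 2) - g = 0 :=
    mul_left_cancel₀ n12 (by linear_combination r1 - r2)
  have s2 : 4 * (b ^ 2 + b * c + c ^ 2) - g = 0 :=
    mul_left_cancel₀ n23 (by linear_combination r2 - r3)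
  have s3 : a + b + c = 0 :=
    mul_left_cancel₀ n31 (by linear_combination (1 / 4 : ℂ) * (s1 - s2))
  have hc : c = -a - b := by linear_combination s3
  subst hc
  linear_combination (x - a) * s1 - r1

/-- Differentiate the cubic relation and cancel ℘'. The cancellation also covers zeros of ℘',
because the ring of analytic functions on a connected domain has no zero divisors. -/
lemma IsHalfPeriods.deriv_derivWeierstrassP (h : IsHalfPeriods L h₁ h₂ h₃) {z : ℂ}
    (hz : z ∉ L.lattice) :
    deriv L.derivWeierstrassP z = 2 * (
      (L.weierstrassP z - L.weierstrassP h₂) * (L.weierstrassP z - L.weierstrassP h₃) +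
      (L.weierstrassP z - L.weierstrassP h₁) * (L.weierstrassP z - L.weierstrassP h₃) +
      (L.weierstrassP z - L.weierstrassP h₁) * (L.weierstrassP z - L.weierstrassP h₂)) := by
  have hU : IsPreconnected ((L.lattice : Set ℂ)ᶜ) :=
    ((countable_lattice L).isPathConnected_compl_of_one_lt_rank
      (by simp)).isConnected.isPreconnected
  have hzero : ∀ z ∈ (L.lattice : Set ℂ)ᶜ, (deriv L.derivWeierstrassP z - 2 * (
      (L.weierstrassP z - L.weierstrassP h₂) * (L.weierstrassP z - L.weierstrassP h₃) +
      (L.weierstrassP z - L.weierstrassP h₁) * (L.weierstrassP z - L.weierstrassP h₃) +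
      (L.weierstrassP z - L.weierstrassP h₁) * (L.weierstrassP z - L.weierstrassP h₂))) *
      L.derivWeierstrassP z = 0 := by
    intro z hz
    have d0 := hasDerivAt_weierstrassP L hz
    have d1 := (analyticAt_derivWeierstrassP L hz).differentiableAt.hasDerivAt.pow 2
    have d2 := (((d0.sub_const (L.weierstrassP h₁)).mul
      (d0.sub_const (L.weierstrassP h₂))).mul (d0.sub_const (L.weierstrassP h₃))).const_mul 4
    have := d1.unique (d2.congr_of_eventuallyEq (by
      filter_upwards [eventually_nhds_notMem L hz] with y hy
      simpa using h.derivWeierstrassP_sq hy))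
    simp only [Nat.cast_ofNat, Pi.mul_apply] at this
    linear_combination (1 / 2 : ℂ) * this
  have ha : AnalyticOnNhd ℂ (fun z => deriv L.derivWeierstrassP z - 2 * (
      (L.weierstrassP z - L.weierstrassP h₂) * (L.weierstrassP z - L.weierstrassP h₃) +
      (L.weierstrassP z - L.weierstrassP h₁) * (L.weierstrassP z - L.weierstrassP h₃) +
      (L.weierstrassP z - L.weierstrassP h₁) * (L.weierstrassP z - L.weierstrassP h₂)))
      (L.lattice : Set ℂ)ᶜ := fun z hz => by
    have a0 := analyticAt_weierstrassP L hz
    have a1 := (analyticAt_derivWeierstrassP L hz).deriv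
    fun_prop
  rcases ha.eq_zero_or_eq_zero_of_mul_eq_zero
    (fun z hz => analyticAt_derivWeierstrassP L hz) hzero hU with h1 | h1
  · exact sub_eq_zero.1 (h1 z hz)
  · exfalso
    -- If ℘' ≡ 0, then ℘ takes only the three values ℘(hᵢ); a value of larger norm contradicts this.
    obtain ⟨y, hy, hye⟩ := exists_weierstrassP_eq_const L
      (1 + ‖L.weierstrassP h₁‖ + ‖L.weierstrassP h₂‖ + ‖L.weierstrassP h₃‖ : ℝ)
    have h2 := h.derivWeierstrassP_sq hy
    rw [h1 y hy] at h2
    have h3 : ‖L.weierstrassP y‖ =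
        1 + ‖L.weierstrassP h₁‖ + ‖L.weierstrassP h₂‖ + ‖L.weierstrassP h₃‖ := by
      rw [hye, Complex.norm_real, Real.norm_of_nonneg (by positivity)]
    have n1 := norm_nonneg (L.weierstrassP h₁)
    have n2 := norm_nonneg (L.weierstrassP h₂)
    have n3 := norm_nonneg (L.weierstrassP h₃)
    simp only [ne_eq, OfNat.ofNat_ne_zero, not_false_eq_true, zero_pow, zero_eq_mul, mul_eq_zero,
      sub_eq_zero, false_or] at h2
    rcases h2 with (h2 | h2) | h2 <;> rw [h2] at h3 <;> linarith

lemma IsHalfPeriods.derivWeierstrassP_add (h : IsHalfPeriods L h₁ h₂ h₃) {z : ℂ}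
    (hz : z ∉ L.lattice) (hz' : z + h₁ ∉ L.lattice) :
    (L.weierstrassP z - L.weierstrassP h₁) ^ 2 * L.derivWeierstrassP (z + h₁) =
      -((L.weierstrassP h₂ - L.weierstrassP h₁) * (L.weierstrassP h₃ - L.weierstrassP h₁) *
        L.derivWeierstrassP z) := by
  have d0 := hasDerivAt_weierstrassP L hz
  have d1 := (hasDerivAt_weierstrassP L hz').comp_add_const z h₁
  have d2 := (d0.sub_const (L.weierstrassP h₁)).mul (d1.sub_const (L.weierstrassP h₁))
  have hshift : ∀ᶠ y in 𝓝 z, y + h₁ ∉ L.lattice :=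
    ((continuous_id.add continuous_const).tendsto z).eventually (eventually_nhds_notMem L hz')
  have := d2.unique ((hasDerivAt_const z ((L.weierstrassP h₂ - L.weierstrassP h₁) *
    (L.weierstrassP h₃ - L.weierstrassP h₁))).congr_of_eventuallyEq (by
      filter_upwards [eventually_nhds_notMem L hz, hshift] with y hy hy'
      exact h.mul_eq hy hy'))
  have h3 := h.mul_eq hz hz'
  linear_combination (L.weierstrassP z - L.weierstrassP h₁) * this - L.derivWeierstrassP z * h3

end Lattice

end EllipticPVI

namespace EllipticPVI

open Filter Set ContDiff

/-! ### Partial derivatives -/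

/-- The partial derivative in the first variable. -/
noncomputable def partial₁ (F : ℂ × ℂ → ℂ) (p : ℂ × ℂ) : ℂ := fderiv ℂ F p (1, 0)

/-- The partial derivative in the second variable. -/
noncomputable def partial₂ (F : ℂ × ℂ → ℂ) (p : ℂ × ℂ) : ℂ := fderiv ℂ F p (0, 1)

lemma contDiffAt_partial₁ {F : ℂ × ℂ → ℂ} {p : ℂ × ℂ} (h : ContDiffAt ℂ ∞ F p) :
    ContDiffAt ℂ ∞ (partial₁ F) p :=
  (h.fderiv_right (m := ∞) (by simp)).clm_apply contDiffAt_const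

lemma contDiffAt_partial₂ {F : ℂ × ℂ → ℂ} {p : ℂ × ℂ} (h : ContDiffAt ℂ ∞ F p) :
    ContDiffAt ℂ ∞ (partial₂ F) p :=
  (h.fderiv_right (m := ∞) (by simp)).clm_apply contDiffAt_const

lemma hasDerivAt_comp_curve {F : ℂ × ℂ → ℂ} {u v : ℂ → ℂ} {u' v' s : ℂ}
    (hF : DifferentiableAt ℂ F (u s, v s)) (hu : HasDerivAt u u' s) (hv : HasDerivAt v v' s) :
    HasDerivAt (fun s => F (u s, v s))
      (partial₁ F (u s, v s) * u' + partial₂ F (u s, v s) * v') s := by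
  have h := hF.hasFDerivAt.comp_hasDerivAt s (hu.prodMk hv)
  convert! h using 1
  rw [show ((u', v') : ℂ × ℂ) = u' • (1, 0) + v' • (0, 1) by simp, map_add, map_smul, map_smul]
  simp [partial₁, partial₂, mul_comm]

lemma hasDerivAt_fst {F : ℂ × ℂ → ℂ} {z τ : ℂ} (hF : DifferentiableAt ℂ F (z, τ)) :
    HasDerivAt (fun z => F (z, τ)) (partial₁ F (z, τ)) z := by
  simpa using hasDerivAt_comp_curve (u := fun z => z) (v := fun _ => τ) hF (hasDerivAt_id z)
    (hasDerivAt_const z τ)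

lemma hasDerivAt_snd {F : ℂ × ℂ → ℂ} {z τ : ℂ} (hF : DifferentiableAt ℂ F (z, τ)) :
    HasDerivAt (fun τ => F (z, τ)) (partial₂ F (z, τ)) τ := by
  simpa using hasDerivAt_comp_curve (u := fun _ => z) (v := fun τ => τ) hF (hasDerivAt_const τ z)
    (hasDerivAt_id τ)

lemma partial₁_partial₂ {F : ℂ × ℂ → ℂ} {p : ℂ × ℂ} (h : ContDiffAt ℂ ∞ F p) :
    partial₁ (partial₂ F) p = partial₂ (partial₁ F) p := by
  have hd : DifferentiableAt ℂ (fderiv ℂ F) p :=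
    (h.fderiv_right (m := ∞) (by simp)).differentiableAt (by simp)
  have hsymm := h.isSymmSndFDerivAt (by
    rw [minSmoothness_of_isRCLikeNormedField]; exact WithTop.coe_le_coe.2 (le_top : (2 : ℕ∞) ≤ ⊤))
  have key : ∀ v w : ℂ × ℂ, fderiv ℂ (fun q => fderiv ℂ F q v) p w = fderiv ℂ (fderiv ℂ F) p w v := by
    intro v w
    rw [fderiv_clm_apply hd (differentiableAt_const v)]
    simp
  have := hsymm (1, 0) (0, 1)
  unfold partial₁ partial₂
  rw [key, key, this]

/-! ### Points outside the lattice -/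

lemma notMem_lattice_iff {τ : ℍ} {z : ℂ} :
    z ∉ (periods τ).lattice ↔ (z, (τ : ℂ)) ∈ offLattice := by
  rw [PeriodPair.mem_lattice]
  simp only [offLattice, periods, mem_ofPred_eq, τ.im_pos, UpperHalfPlane.coe_im, true_and, mul_one,
    not_exists]
  exact forall₂_congr fun m n => ⟨fun h h' => h h'.symm, fun h h' => h h'.symm⟩

lemma one_mem_lattice (τ : ℍ) : (1 : ℂ) ∈ (periods τ).lattice := (periods τ).ω₁_mem_lattice

lemma tau_mem_lattice (τ : ℍ) : (τ : ℂ) ∈ (periods τ).lattice := (periods τ).ω₂_mem_lattice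

lemma offLattice_add {τ : ℍ} {z w : ℂ} (hw : w ∈ (periods τ).lattice)
    (hz : (z, (τ : ℂ)) ∈ offLattice) : (z + w, (τ : ℂ)) ∈ offLattice := by
  rw [← notMem_lattice_iff] at *
  rwa [add_mem_lattice_iff _ hw]

lemma offLattice_neg {τ : ℍ} {z : ℂ} (hz : (z, (τ : ℂ)) ∈ offLattice) :
    (-z, (τ : ℂ)) ∈ offLattice := by
  rw [← notMem_lattice_iff] at *
  rwa [neg_mem_iff]

lemma eventually_offLattice {p : ℂ × ℂ} (h : p ∈ offLattice) : ∀ᶠ q in 𝓝 p, q ∈ offLattice :=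
  isOpen_offLattice.mem_nhds h

lemma eventually_offLattice_fst {z τ : ℂ} (h : (z, τ) ∈ offLattice) :
    ∀ᶠ y in 𝓝 z, (y, τ) ∈ offLattice :=
  ((by fun_prop : Continuous fun y : ℂ => (y, τ)).tendsto z).eventually (eventually_offLattice h)

/-- The w that work at all off-lattice points form a subgroup of the lattice, and it contains both
generators. -/
lemma periodic_of_generators {τ : ℍ} {f : ℂ → ℂ}
    (h1 : ∀ z, (z, (τ : ℂ)) ∈ offLattice → f (z + 1) = f z)
    (h2 : ∀ z, (z, (τ : ℂ)) ∈ offLattice → f (z + τ) = f z) (z w : ℂ)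
    (hw : w ∈ (periods τ).lattice) : ∀ᶠ y in 𝓝[≠] z, f (y + w) = f y := by
  let S : AddSubgroup ℂ :=
    { carrier := {w | w ∈ (periods τ).lattice ∧ ∀ z, (z, (τ : ℂ)) ∈ offLattice → f (z + w) = f z}
      add_mem' := by
        rintro a b ⟨ha, ha'⟩ ⟨hb, hb'⟩
        refine ⟨add_mem ha hb, fun z hz => ?_⟩
        rw [← add_assoc, hb' _ (offLattice_add ha hz), ha' z hz]
      zero_mem' := ⟨zero_mem _, fun z _ => by rw [add_zero]⟩
      neg_mem' := by
        rintro a ⟨ha, ha'⟩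
        refine ⟨neg_mem ha, fun z hz => ?_⟩
        rw [← ha' _ (offLattice_add (neg_mem ha) hz), neg_add_cancel_right] }
  have hS : (periods τ).lattice ≤ S.toIntSubmodule := by
    refine Submodule.span_le.2 ?_
    rintro x (rfl | rfl)
    · exact ⟨one_mem_lattice τ, h1⟩
    · exact ⟨tau_mem_lattice τ, h2⟩
  filter_upwards [eventually_nhdsNE_notMem (periods τ) z] with y hy
  exact (hS hw).2 y (notMem_lattice_iff.1 hy)

lemma removable_everywhere {τ : ℍ} {f : ℂ → ℂ}
    (hper : ∀ z, ∀ w ∈ (periods τ).lattice, ∀ᶠ y in 𝓝[≠] z, f (y + w) = f y)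
    (h0 : Removable f 0) (han : ∀ z, (z, (τ : ℂ)) ∈ offLattice → AnalyticAt ℂ f z) (z : ℂ) :
    Removable f z := by
  by_cases hz : z ∈ (periods τ).lattice
  · refine Removable.of_add (w := -z) ?_ (hper z _ (neg_mem hz))
    rwa [add_neg_cancel]
  · exact ⟨f, han z (notMem_lattice_iff.1 hz), .rfl⟩

lemma exists_const_of_offLattice {τ : ℍ} {f : ℂ → ℂ}
    (h1 : ∀ z, (z, (τ : ℂ)) ∈ offLattice → f (z + 1) = f z)
    (h2 : ∀ z, (z, (τ : ℂ)) ∈ offLattice → f (z + τ) = f z)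
    (h0 : Removable f 0) (han : ∀ z, (z, (τ : ℂ)) ∈ offLattice → AnalyticAt ℂ f z) :
    ∃ c, ∀ z, (z, (τ : ℂ)) ∈ offLattice → f z = c := by
  have hper := periodic_of_generators h1 h2
  obtain ⟨c, hc⟩ := exists_const_of_elliptic (periods τ) hper (removable_everywhere hper h0 han)
  exact ⟨c, fun z hz => eq_of_continuousAt_of_eventuallyEq_const (han z hz).continuousAt (hc z)⟩

lemma analyticAt_fst {F : ℂ × ℂ → ℂ} {z τ : ℂ} (h : ContDiffAt ℂ 1 F (z, τ)) :
    AnalyticAt ℂ (fun z => F (z, τ)) z := by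
  rw [Complex.analyticAt_iff_eventually_differentiableAt]
  have h1 : ∀ᶠ q in 𝓝 (z, τ), ContDiffAt ℂ 1 F q := h.eventually (by simp)
  have h2 := ((by fun_prop : Continuous fun y : ℂ => (y, τ)).tendsto z).eventually h1
  filter_upwards [h2] with y hy
  exact (hasDerivAt_fst (hy.differentiableAt (by simp))).differentiableAt

lemma Removable.sub {f g : ℂ → ℂ} {z : ℂ} (hf : Removable f z) (hg : Removable g z) :
    Removable (fun y => f y - g y) z := by
  obtain ⟨F, hF, hfF⟩ := hf
  obtain ⟨G, hG, hgG⟩ := hg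
  exact ⟨fun y => F y - G y, hF.sub hG, hfF.sub hgG⟩

lemma Removable.deriv {f : ℂ → ℂ} {z : ℂ} (hf : Removable f z) : Removable (deriv f) z := by
  obtain ⟨F, hF, hfF⟩ := hf
  refine ⟨_root_.deriv F, hF.deriv, ?_⟩
  filter_upwards [eventually_eventually_nhdsWithin.2 hfF, self_mem_nhdsWithin] with y hy hyz
  rw [IsOpen.nhdsWithin_eq isOpen_compl_singleton hyz] at hy
  exact Filter.EventuallyEq.deriv_eq hy

/-! ### Quasi-periodicity of the partial derivatives of `zeta` -/

section

variable {τ : ℍ} {z : ℂ}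

lemma differentiableAt_zeta {p : ℂ × ℂ} (h : p ∈ offLattice) : DifferentiableAt ℂ zeta p :=
  (contDiffAt_zeta h).differentiableAt (by simp)

lemma hasDerivAt_zeta (h : (z, (τ : ℂ)) ∈ offLattice) :
    HasDerivAt (fun z => zeta (z, (τ : ℂ))) (partial₁ zeta (z, τ)) z :=
  hasDerivAt_fst (differentiableAt_zeta h)

lemma partial₁_zeta_add_one (h : (z, (τ : ℂ)) ∈ offLattice) :
    partial₁ zeta (z + 1, τ) = partial₁ zeta (z, τ) :=
  ((hasDerivAt_zeta (offLattice_add (one_mem_lattice τ) h)).comp_add_const z 1).unique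
    ((hasDerivAt_zeta h).congr_of_eventuallyEq (.of_forall fun y => zeta_add_one y τ))

lemma partial₂_zeta_add_one (h : (z, (τ : ℂ)) ∈ offLattice) :
    partial₂ zeta (z + 1, τ) = partial₂ zeta (z, τ) :=
  (hasDerivAt_snd (differentiableAt_zeta (offLattice_add (one_mem_lattice τ) h))).unique
    ((hasDerivAt_snd (differentiableAt_zeta h)).congr_of_eventuallyEq
      (.of_forall fun s => zeta_add_one z s))

lemma partial₁_zeta_add_tau (h : (z, (τ : ℂ)) ∈ offLattice) :
    partial₁ zeta (z + τ, τ) = partial₁ zeta (z, τ) :=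
  ((hasDerivAt_zeta (offLattice_add (tau_mem_lattice τ) h)).comp_add_const z τ).unique
    (((hasDerivAt_zeta h).sub_const (2 * Real.pi * Complex.I)).congr_of_eventuallyEq (by
      filter_upwards [eventually_offLattice_fst h] with y hy
      exact zeta_add_tau hy))

/-- The shift z + τ itself moves with τ, so the chain rule contributes the extra ∂ζ/∂z. -/
lemma partial₂_zeta_add_tau (h : (z, (τ : ℂ)) ∈ offLattice) :
    partial₂ zeta (z + τ, τ) = partial₂ zeta (z, τ) - partial₁ zeta (z, τ) := by
  have h1 := hasDerivAt_comp_curve (F := zeta) (u := fun s => z + s) (v := fun s => s) (s := τ)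
    (differentiableAt_zeta (offLattice_add (tau_mem_lattice τ) h))
    ((hasDerivAt_id (τ : ℂ)).const_add z) (hasDerivAt_id (τ : ℂ))
  have h2 := (hasDerivAt_snd (differentiableAt_zeta h)).sub_const (2 * Real.pi * Complex.I)
  have h3 := h1.unique (h2.congr_of_eventuallyEq (by
    have := ((by fun_prop : Continuous fun s : ℂ => (z, s)).tendsto (τ : ℂ)).eventually
      (eventually_offLattice h)
    filter_upwards [this] with s hs
    exact zeta_add_tau hs))
  rw [← h3, partial₁_zeta_add_tau h]
  ring

lemma partial₁_zeta_neg (h : (z, (τ : ℂ)) ∈ offLattice) :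
    partial₁ zeta (-z, τ) = partial₁ zeta (z, τ) := by
  have h1 := (hasDerivAt_zeta (offLattice_neg h)).comp z (hasDerivAt_neg z)
  have h2 := h1.unique ((hasDerivAt_zeta h).neg.congr_of_eventuallyEq (by
      filter_upwards [eventually_offLattice_fst h] with y hy
      exact zeta_neg hy))
  simpa using h2

lemma partial₂_zeta_neg (h : (z, (τ : ℂ)) ∈ offLattice) :
    partial₂ zeta (-z, τ) = -partial₂ zeta (z, τ) :=
  (hasDerivAt_snd (differentiableAt_zeta (offLattice_neg h))).unique
    ((hasDerivAt_snd (differentiableAt_zeta h)).neg.congr_of_eventuallyEq (by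
      have := ((by fun_prop : Continuous fun s : ℂ => (z, s)).tendsto (τ : ℂ)).eventually
        (eventually_offLattice h)
      filter_upwards [this] with s hs
      exact zeta_neg hs))

/-! ### Behaviour at the origin -/

/-- Laurent expansion of `zeta` at the origin. -/
lemma exists_zeta_laurent (τ : ℍ) : ∃ r : ℂ → ℂ, AnalyticAt ℂ r 0 ∧ r 0 = 0 ∧
    (∀ᶠ y in 𝓝[≠] (0 : ℂ), zeta (y, τ) = 1 / y + r y) ∧
    (∀ᶠ y in 𝓝[≠] (0 : ℂ), partial₁ zeta (y, τ) = -1 / y ^ 2 + deriv r y) ∧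
    Removable (fun y => partial₂ zeta (y, τ)) 0 := by
  obtain ⟨R, hR, hRe⟩ := exists_zeta_eq_inv_add τ.im_pos
  have hcont : Tendsto (fun y : ℂ => (y, (τ : ℂ))) (𝓝[≠] 0) (𝓝 (0, (τ : ℂ))) :=
    ((by fun_prop : Continuous fun y : ℂ => (y, (τ : ℂ))).tendsto 0).mono_left nhdsWithin_le_nhds
  have hr : AnalyticAt ℂ (fun y => R (y, (τ : ℂ))) 0 := analyticAt_fst (hR.of_le (by simp))
  have h1 : ∀ᶠ y in 𝓝[≠] (0 : ℂ), zeta (y, τ) = 1 / y + R (y, τ) := by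
    filter_upwards [hcont.eventually hRe, self_mem_nhdsWithin] with y hy hy0
    exact hy hy0
  refine ⟨fun y => R (y, τ), hr, ?_, h1, ?_, ?_⟩
  -- Oddness of ζ makes its regular part odd near 0, so it vanishes there.
  · have hneg : Tendsto (fun y : ℂ => -y) (𝓝[≠] 0) (𝓝[≠] 0) := by
      have := (continuous_neg (G := ℂ)).continuousAt (x := 0)
      refine tendsto_nhdsWithin_of_tendsto_nhds_of_eventually_within _
        ((by simpa using this.tendsto : Tendsto (fun y : ℂ => -y) (𝓝 0) (𝓝 0)).mono_left
          nhdsWithin_le_nhds) ?_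
      filter_upwards [self_mem_nhdsWithin] with y hy
      simpa using hy
    have ht : Tendsto (fun y => R (y, (τ : ℂ))) (𝓝[≠] 0) (𝓝 (R (0, τ))) :=
      hr.continuousAt.tendsto.mono_left nhdsWithin_le_nhds
    have ht2 : Tendsto (fun y => R (-y, (τ : ℂ))) (𝓝[≠] 0) (𝓝 (R (0, τ))) := ht.comp hneg
    have ht3 : (fun y => R (-y, (τ : ℂ))) =ᶠ[𝓝[≠] 0] fun y => -R (y, (τ : ℂ)) := by
      filter_upwards [h1, hneg.eventually h1, eventually_nhdsNE_notMem (periods τ) 0,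
        self_mem_nhdsWithin] with y hy1 hy2 hy3 hy4
      have hy0 : y ≠ 0 := hy4
      have := zeta_neg (notMem_lattice_iff.1 hy3)
      rw [hy1, hy2] at this
      have h5 : 1 / -y = -(1 / y) := by field_simp
      rw [h5] at this
      linear_combination this
    exact CharZero.eq_neg_self_iff.1 (tendsto_nhds_unique (ht2.congr' ht3) ht.neg)
  · filter_upwards [eventually_eventually_nhdsWithin.2 h1, self_mem_nhdsWithin,
      eventually_nhdsNE_notMem (periods τ) 0,
      hr.eventually_analyticAt.filter_mono nhdsWithin_le_nhds] with y hy hy0 hyL hyr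
    rw [IsOpen.nhdsWithin_eq isOpen_compl_singleton hy0] at hy
    have hy0' : y ≠ 0 := hy0
    have h2 : HasDerivAt (fun y : ℂ => 1 / y) (-1 / y ^ 2) y := by
      convert! hasDerivAt_inv hy0' using 1
      · ext y; simp
      · field_simp
    exact (hasDerivAt_zeta (notMem_lattice_iff.1 hyL)).unique
      ((h2.add hyr.differentiableAt.hasDerivAt).congr_of_eventuallyEq hy)
  -- The polar part 1/y does not depend on τ and disappears under ∂/∂τ.
  · refine ⟨fun y => partial₂ R (y, τ),
      analyticAt_fst ((contDiffAt_partial₂ hR).of_le (by simp)), ?_⟩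
    filter_upwards [hcont.eventually (eventually_eventually_nhds.2 hRe), self_mem_nhdsWithin,
      hcont.eventually ((hR.of_le (by simp : (1 : ℕ∞ω) ≤ ∞)).eventually (by simp)),
      eventually_nhdsNE_notMem (periods τ) 0] with y hy hy0 hyR hyL
    have h2 := (hasDerivAt_snd (hyR.differentiableAt (by simp))).const_add (1 / y)
    refine (hasDerivAt_snd (differentiableAt_zeta (notMem_lattice_iff.1 hyL))).unique
      (h2.congr_of_eventuallyEq ?_)
    have h3 := ((by fun_prop : Continuous fun s : ℂ => (y, s)).tendsto (τ : ℂ)).eventually hy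
    filter_upwards [h3] with s hs
    exact hs hy0

/-! ### The function `℘` up to a constant, and the heat equation -/

/-- The Weierstrass function up to a function of `τ`. -/
noncomputable def shiftedP (p : ℂ × ℂ) : ℂ := -partial₁ zeta p

lemma contDiffAt_shiftedP {p : ℂ × ℂ} (h : p ∈ offLattice) : ContDiffAt ℂ ∞ shiftedP p :=
  (contDiffAt_partial₁ (contDiffAt_zeta h)).neg

/-- Both functions are elliptic with principal part 1/z². Since C drops out of every quotient of
differences, no τ-derivative of ℘ itself is ever needed. -/
lemma exists_wp_eq (τ : ℍ) : ∃ C, ∀ z, (z, (τ : ℂ)) ∈ offLattice → wp τ z = shiftedP (z, τ) + C := by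
  obtain ⟨r, hr, -, -, h2, -⟩ := exists_zeta_laurent τ
  obtain ⟨E, hE, hEe⟩ := exists_weierstrassP_eq (periods τ)
  obtain ⟨c, hc⟩ := exists_const_of_offLattice (τ := τ) (f := fun z => wp τ z - shiftedP (z, τ))
    (fun z hz => by
      simp only [shiftedP, partial₁_zeta_add_one hz, wp]
      rw [weierstrassP_add _ _ (one_mem_lattice τ)])
    (fun z hz => by
      simp only [shiftedP, partial₁_zeta_add_tau hz, wp]
      rw [weierstrassP_add _ _ (tau_mem_lattice τ)])
    ⟨fun y => E y + deriv r y, hE.add hr.deriv, by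
      filter_upwards [h2] with y hy
      rw [shiftedP, hy, wp, hEe]
      ring⟩
    (fun z hz => (analyticAt_weierstrassP _ (notMem_lattice_iff.2 hz)).sub
      (analyticAt_fst ((contDiffAt_shiftedP hz).of_le (by simp))))
  exact ⟨c, fun z hz => by rw [← hc z hz]; ring⟩

/-- The right side is ∂/∂z (∂ζ/∂z + ζ²). Under z ↦ z + τ both sides change by -4πi ∂ζ/∂z, so their
difference f is elliptic; it is also pole-free and odd, hence zero. -/
lemma heat_zeta (h : (z, (τ : ℂ)) ∈ offLattice) :
    4 * Real.pi * Complex.I * partial₂ zeta (z, τ) =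
      -partial₁ shiftedP (z, τ) - 2 * zeta (z, τ) * shiftedP (z, τ) := by
  have hd : ∀ z, (z, (τ : ℂ)) ∈ offLattice →
      HasDerivAt (fun z => partial₁ zeta (z, τ) + zeta (z, (τ : ℂ)) ^ 2)
        (-partial₁ shiftedP (z, τ) - 2 * zeta (z, τ) * shiftedP (z, τ)) z := by
    intro z hz
    have h1 := hasDerivAt_fst ((contDiffAt_shiftedP hz).differentiableAt (by simp))
    have h2 := h1.neg.add ((hasDerivAt_zeta hz).pow 2)
    convert! h2 using 1
    · ext y; simp [shiftedP]
    · simp [shiftedP]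
  let f : ℂ → ℂ := fun z => 4 * Real.pi * Complex.I * partial₂ zeta (z, τ) -
    deriv (fun z => partial₁ zeta (z, τ) + zeta (z, (τ : ℂ)) ^ 2) z
  have hf : ∀ z, (z, (τ : ℂ)) ∈ offLattice → f z = 4 * Real.pi * Complex.I * partial₂ zeta (z, τ) -
      (-partial₁ shiftedP (z, τ) - 2 * zeta (z, τ) * shiftedP (z, τ)) := fun z hz => by
    simp only [f, (hd z hz).deriv]
  have hp1 : ∀ z, (z, (τ : ℂ)) ∈ offLattice →
      HasDerivAt (fun z => shiftedP (z, (τ : ℂ))) (partial₁ shiftedP (z, τ)) z := fun z hz =>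
    hasDerivAt_fst ((contDiffAt_shiftedP hz).differentiableAt (by simp))
  obtain ⟨c, hc⟩ := exists_const_of_offLattice (τ := τ) (f := f)
    (fun z hz => by
      have hz' := offLattice_add (one_mem_lattice τ) hz
      have h1 := ((hp1 _ hz').comp_add_const z 1).unique ((hp1 z hz).congr_of_eventuallyEq (by
        filter_upwards [eventually_offLattice_fst hz] with y hy
        simp only [shiftedP, partial₁_zeta_add_one hy]))
      rw [hf z hz, hf _ hz', h1, partial₂_zeta_add_one hz, zeta_add_one]
      simp only [shiftedP, partial₁_zeta_add_one hz])
    (fun z hz => by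
      have hz' := offLattice_add (tau_mem_lattice τ) hz
      have h1 := ((hp1 _ hz').comp_add_const z τ).unique ((hp1 z hz).congr_of_eventuallyEq (by
        filter_upwards [eventually_offLattice_fst hz] with y hy
        simp only [shiftedP, partial₁_zeta_add_tau hy]))
      rw [hf z hz, hf _ hz', h1, partial₂_zeta_add_tau hz, zeta_add_tau hz]
      simp only [shiftedP, partial₁_zeta_add_tau hz]
      ring)
    (by
      obtain ⟨r, hr, hr0, h1, h2, h3⟩ := exists_zeta_laurent τ
      obtain ⟨r₁, hr₁, -, hr₁e⟩ := exists_analyticAt_eq_mul hr hr0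
      refine Removable.sub ?_ (Removable.deriv ?_)
      · obtain ⟨g, hg, hge⟩ := h3
        exact ⟨fun y => 4 * Real.pi * Complex.I * g y, analyticAt_const.mul hg,
          hge.fun_comp fun x => 4 * Real.pi * Complex.I * x⟩
      · have := hr.deriv
        -- In ∂ζ/∂z + ζ² the terms ∓1/y² cancel, and the cross term 2r/y is regular because r(0) =
        -- 0.
        refine ⟨fun y => deriv r y + 2 * r₁ y + r y ^ 2, by fun_prop, ?_⟩
        filter_upwards [h1, h2, self_mem_nhdsWithin] with y hy1 hy2 hy0
        have hy0' : y ≠ 0 := hy0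
        rw [hy1, hy2, hr₁e]
        field_simp
        ring)
    (fun z hz => by
      refine AnalyticAt.sub (analyticAt_const.mul
        (analyticAt_fst ((contDiffAt_partial₂ (contDiffAt_zeta hz)).of_le (by simp))))
        (AnalyticAt.deriv (AnalyticAt.add ?_ (AnalyticAt.pow ?_ 2)))
      · exact analyticAt_fst ((contDiffAt_partial₁ (contDiffAt_zeta hz)).of_le (by simp))
      · exact analyticAt_fst ((contDiffAt_zeta hz).of_le (by simp)))
  have hz' := offLattice_neg h
  have hneg : f (-z) = -f z := by
    have h1 := ((hp1 _ hz').comp z (hasDerivAt_neg z)).unique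
      ((hp1 z h).congr_of_eventuallyEq (by
        filter_upwards [eventually_offLattice_fst h] with y hy
        simp only [shiftedP, Function.comp_apply, partial₁_zeta_neg hy]))
    rw [hf z h, hf _ hz', partial₂_zeta_neg h, zeta_neg h, ← h1]
    simp only [shiftedP, partial₁_zeta_neg h]
    ring
  rw [hc _ hz', hc _ h] at hneg
  have h5 := hc z h
  rw [CharZero.eq_neg_self_iff.1 hneg, hf z h] at h5
  exact sub_eq_zero.1 h5

/-- The constant `1 / (4 π i)`. -/
noncomputable def heatConst : ℂ := 1 / (4 * Real.pi * Complex.I)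

lemma partial₂_zeta (h : (z, (τ : ℂ)) ∈ offLattice) :
    partial₂ zeta (z, τ) =
      heatConst * (-partial₁ shiftedP (z, τ) - 2 * zeta (z, τ) * shiftedP (z, τ)) := by
  rw [← heat_zeta h, heatConst]
  have := Complex.two_pi_I_ne_zero
  field_simp

/-- The z-derivative of the heat equation, by symmetry of mixed partials. -/
lemma partial₂_shiftedP (h : (z, (τ : ℂ)) ∈ offLattice) :
    partial₂ shiftedP (z, τ) = heatConst * (partial₁ (partial₁ shiftedP) (z, τ) +
      2 * zeta (z, τ) * partial₁ shiftedP (z, τ) - 2 * shiftedP (z, τ) ^ 2) := by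
  have hP := contDiffAt_shiftedP h
  have h0 : partial₂ shiftedP (z, τ) = -partial₁ (partial₂ zeta) (z, τ) := by
    rw [partial₁_partial₂ (contDiffAt_zeta h), partial₂,
      show shiftedP = -partial₁ zeta from rfl, fderiv_neg]
    rfl
  have h1 := hasDerivAt_fst ((contDiffAt_partial₂ (contDiffAt_zeta h)).differentiableAt (by simp))
  have h2 := hasDerivAt_fst ((contDiffAt_partial₁ hP).differentiableAt (by simp))
  have h3 := hasDerivAt_fst (hP.differentiableAt (by simp))
  have h4 := (h2.neg.sub (((hasDerivAt_zeta h).const_mul 2).mul h3)).const_mul heatConst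
  have h5 := h1.unique (h4.congr_of_eventuallyEq (by
    filter_upwards [eventually_offLattice_fst h] with y hy
    simpa using partial₂_zeta hy))
  rw [h0, h5, show partial₁ zeta (z, (τ : ℂ)) = -shiftedP (z, τ) by simp [shiftedP]]
  ring

end

end EllipticPVI

namespace EllipticPVI

open Filter Set ContDiff

/-! ### The branch points as functions of `τ` -/

lemma half_notMem_lattice {τ : ℍ} {z : ℂ} (m n : ℤ) (h : ¬ (Even m ∧ Even n))
    (hz : z = m / 2 + n * τ / 2) : z ∉ (periods τ).lattice := by
  rw [PeriodPair.mem_lattice]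
  rintro ⟨k, l, hkl⟩
  simp only [periods, mul_one] at hkl
  rw [hz] at hkl
  have him := congrArg Complex.im hkl
  have hre := congrArg Complex.re hkl
  simp at him hre
  have hl : (n : ℝ) = 2 * l := by
    apply mul_right_cancel₀ τ.im_pos.ne'
    linarith
  have hk : (m : ℝ) = 2 * k := by
    rw [hl] at hre
    linarith
  have hl' : n = 2 * l := by exact_mod_cast hl
  have hk' : m = 2 * k := by exact_mod_cast hk
  exact h ⟨⟨k, by omega⟩, ⟨l, by omega⟩⟩

lemma isHalfPeriods (τ : ℍ) :
    IsHalfPeriods (periods τ) (1 / 2) (-(1 / 2) - (τ : ℂ) / 2) ((τ : ℂ) / 2) where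
  notMem₁ := half_notMem_lattice 1 0 (by simp) (by simp)
  notMem₂ := half_notMem_lattice (-1) (-1) (by simp) (by push_cast; ring)
  notMem₃ := half_notMem_lattice 0 1 (by simp) (by simp)
  two₁ := PeriodPair.mem_lattice.2 ⟨1, 0, by simp [periods]; norm_num⟩
  two₂ := PeriodPair.mem_lattice.2 ⟨-1, -1, by simp [periods]; ring⟩
  two₃ := PeriodPair.mem_lattice.2 ⟨0, 1, by simp [periods]⟩
  sum := PeriodPair.mem_lattice.2 ⟨0, 0, by push_cast; ring⟩

/-- The branch point at `1 / 2`, as a function of a complex variable. -/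
noncomputable def branch₁ (s : ℂ) : ℂ := shiftedP (1 / 2, s)

/-- The branch point at `-1 / 2 - τ / 2`, as a function of a complex variable. -/
noncomputable def branch₂ (s : ℂ) : ℂ := shiftedP (-(1 / 2) - s / 2, s)

/-- The branch point at `τ / 2`, as a function of a complex variable. -/
noncomputable def branch₃ (s : ℂ) : ℂ := shiftedP (s / 2, s)

/-- The difference `e₂ - e₁`, as a function of a complex variable. -/
noncomputable def gap (s : ℂ) : ℂ := branch₂ s - branch₁ s

/-- The modular function `t`, as a function of a complex variable. -/
noncomputable def modT (s : ℂ) : ℂ := (branch₃ s - branch₁ s) / gap s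

/-- The normalized Weierstrass function `(℘ - e₁) / (e₂ - e₁)`. -/
noncomputable def normP (p : ℂ × ℂ) : ℂ := (shiftedP p - branch₁ p.2) / gap p.2

section

variable {τ : ℍ} {z : ℂ}

lemma offLattice_half₁ (τ : ℍ) : (1 / 2, (τ : ℂ)) ∈ offLattice :=
  notMem_lattice_iff.1 (isHalfPeriods τ).notMem₁

lemma offLattice_half₂ (τ : ℍ) : (-(1 / 2) - (τ : ℂ) / 2, (τ : ℂ)) ∈ offLattice :=
  notMem_lattice_iff.1 (isHalfPeriods τ).notMem₂

lemma offLattice_half₃ (τ : ℍ) : ((τ : ℂ) / 2, (τ : ℂ)) ∈ offLattice :=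
  notMem_lattice_iff.1 (isHalfPeriods τ).notMem₃

lemma exists_wp_branch_eq (τ : ℍ) : ∃ C, e₁ τ = branch₁ τ + C ∧ e₂ τ = branch₂ τ + C ∧
    e₃ τ = branch₃ τ + C ∧ ∀ z, (z, (τ : ℂ)) ∈ offLattice → wp τ z = shiftedP (z, τ) + C := by
  obtain ⟨C, hC⟩ := exists_wp_eq τ
  exact ⟨C, hC _ (offLattice_half₁ τ), hC _ (offLattice_half₂ τ), hC _ (offLattice_half₃ τ), hC⟩

lemma tMod_eq (τ : ℍ) : tMod τ = modT τ := by
  obtain ⟨C, h1, h2, h3, -⟩ := exists_wp_branch_eq τ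
  simp only [tMod, modT, gap, h1, h2, h3, add_sub_add_right_eq_sub]

lemma wp_sub_div_eq (h : (z, (τ : ℂ)) ∈ offLattice) :
    (wp τ z - e₁ τ) / (e₂ τ - e₁ τ) = normP (z, τ) := by
  obtain ⟨C, h1, h2, h3, h4⟩ := exists_wp_branch_eq τ
  simp only [normP, gap, h1, h2, h4 z h, add_sub_add_right_eq_sub]

lemma gap_ne_zero (τ : ℍ) : gap τ ≠ 0 := by
  obtain ⟨C, h1, h2, -, -⟩ := exists_wp_branch_eq τ
  have h : e₂ τ ≠ e₁ τ := (isHalfPeriods τ).weierstrassP_ne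
  rw [h1, h2] at h
  exact fun h' => h (by rw [sub_eq_zero.1 h'])

lemma shiftedP_eq (z : ℂ) {s : ℂ} (h : gap s ≠ 0) :
    shiftedP (z, s) = branch₁ s + gap s * normP (z, s) := by
  rw [normP]; field_simp; ring

lemma branch₃_eq (s : ℂ) (h : gap s ≠ 0) : branch₃ s = branch₁ s + gap s * modT s := by
  rw [modT]; field_simp; ring

lemma branch₂_eq (s : ℂ) : branch₂ s = branch₁ s + gap s := by
  rw [gap]; ring

lemma modT_ne_zero (τ : ℍ) : modT τ ≠ 0 := by
  obtain ⟨C, h1, -, h3, -⟩ := exists_wp_branch_eq τ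
  have h : e₁ τ ≠ e₃ τ := (isHalfPeriods τ).rotate.rotate.weierstrassP_ne
  rw [h1, h3] at h
  intro h'
  rw [branch₃_eq _ (gap_ne_zero τ), h'] at h
  simp at h

lemma modT_ne_one (τ : ℍ) : modT τ ≠ 1 := by
  obtain ⟨C, -, h2, h3, -⟩ := exists_wp_branch_eq τ
  have h : e₃ τ ≠ e₂ τ := (isHalfPeriods τ).rotate.weierstrassP_ne
  rw [h2, h3] at h
  intro h'
  rw [branch₃_eq _ (gap_ne_zero τ), h', branch₂_eq] at h
  simp at h

/-! ### Differential equations of ℘ in normalised coordinates, and derivatives in τ. -/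

lemma hasDerivAt_wp (h : (z, (τ : ℂ)) ∈ offLattice) :
    HasDerivAt (fun z => shiftedP (z, (τ : ℂ))) (partial₁ shiftedP (z, τ)) z :=
  hasDerivAt_fst ((contDiffAt_shiftedP h).differentiableAt (by simp))

lemma partial₁_shiftedP (h : (z, (τ : ℂ)) ∈ offLattice) :
    partial₁ shiftedP (z, τ) = wpDeriv τ z := by
  obtain ⟨C, hC⟩ := exists_wp_eq τ
  refine (hasDerivAt_wp h).unique
    (((hasDerivAt_weierstrassP _ (notMem_lattice_iff.2 h)).sub_const C).congr_of_eventuallyEq ?_)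
  filter_upwards [eventually_offLattice_fst h] with y hy
  have := hC y hy
  simp only [wp] at this
  rw [this]; ring

lemma partial₁_shiftedP_sq (h : (z, (τ : ℂ)) ∈ offLattice) :
    partial₁ shiftedP (z, τ) ^ 2 = 4 * gap τ ^ 3 *
      (normP (z, τ) * (normP (z, τ) - 1) * (normP (z, τ) - modT τ)) := by
  obtain ⟨C, h1, h2, h3, h4⟩ := exists_wp_branch_eq τ
  have key : wpDeriv τ z ^ 2 = 4 * ((wp τ z - e₁ τ) * (wp τ z - e₂ τ) * (wp τ z - e₃ τ)) :=
    (isHalfPeriods τ).derivWeierstrassP_sq (notMem_lattice_iff.2 h)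
  rw [partial₁_shiftedP h, key, h1, h2, h3, h4 z h, shiftedP_eq _ (gap_ne_zero τ),
    branch₃_eq _ (gap_ne_zero τ), branch₂_eq]
  generalize normP (z, (τ : ℂ)) = X
  ring

lemma partial₁_partial₁_shiftedP (h : (z, (τ : ℂ)) ∈ offLattice) :
    partial₁ (partial₁ shiftedP) (z, τ) = 2 *
      ((shiftedP (z, τ) - branch₂ τ) * (shiftedP (z, τ) - branch₃ τ) +
      (shiftedP (z, τ) - branch₁ τ) * (shiftedP (z, τ) - branch₃ τ) +
      (shiftedP (z, τ) - branch₁ τ) * (shiftedP (z, τ) - branch₂ τ)) := by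
  obtain ⟨C, h1, h2, h3, h4⟩ := exists_wp_branch_eq τ
  have key : deriv (periods τ).derivWeierstrassP z =
      2 * ((wp τ z - e₂ τ) * (wp τ z - e₃ τ) + (wp τ z - e₁ τ) * (wp τ z - e₃ τ) +
        (wp τ z - e₁ τ) * (wp τ z - e₂ τ)) :=
    (isHalfPeriods τ).deriv_derivWeierstrassP (notMem_lattice_iff.2 h)
  have hd : partial₁ (partial₁ shiftedP) (z, τ) = deriv (periods τ).derivWeierstrassP z := by
    refine (hasDerivAt_fst ((contDiffAt_partial₁ (contDiffAt_shiftedP h)).differentiableAt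
      (by simp))).unique ((analyticAt_derivWeierstrassP _
        (notMem_lattice_iff.2 h)).differentiableAt.hasDerivAt.congr_of_eventuallyEq ?_)
    filter_upwards [eventually_offLattice_fst h] with y hy
    exact partial₁_shiftedP hy
  rw [hd, key, h1, h2, h3, h4 z h]
  ring

/-- The transcendental ζ appears only in the combination δ' + 2cζ, with c = `heatConst`; this
grouping is what later lets it be eliminated. -/
lemma hasDerivAt_shiftedP_comp {δ : ℂ → ℂ} {δ' : ℂ} (h : (δ τ, (τ : ℂ)) ∈ offLattice)
    (hδ : HasDerivAt δ δ' τ) :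
    HasDerivAt (fun s => shiftedP (δ s, s)) (partial₁ shiftedP (δ τ, τ) *
      (δ' + 2 * heatConst * zeta (δ τ, τ)) +
      heatConst * (partial₁ (partial₁ shiftedP) (δ τ, τ) - 2 * shiftedP (δ τ, τ) ^ 2)) τ := by
  have h1 := hasDerivAt_comp_curve (F := shiftedP) (v := fun s => s) (s := τ)
    ((contDiffAt_shiftedP h).differentiableAt (by simp)) hδ (hasDerivAt_id (τ : ℂ))
  rw [partial₂_shiftedP h] at h1
  convert! h1 using 1
  ring

lemma hasDerivAt_zeta_comp {δ : ℂ → ℂ} {δ' : ℂ} (h : (δ τ, (τ : ℂ)) ∈ offLattice)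
    (hδ : HasDerivAt δ δ' τ) :
    HasDerivAt (fun s => zeta (δ s, s)) (-(shiftedP (δ τ, τ) *
      (δ' + 2 * heatConst * zeta (δ τ, τ)) + heatConst * partial₁ shiftedP (δ τ, τ))) τ := by
  have h1 := hasDerivAt_comp_curve (F := zeta) (v := fun s => s) (s := τ)
    (differentiableAt_zeta h) hδ (hasDerivAt_id (τ : ℂ))
  rw [partial₂_zeta h, show partial₁ zeta (δ τ, (τ : ℂ)) = -shiftedP (δ τ, τ) by
    simp [shiftedP]] at h1
  convert! h1 using 1
  ring

/-- At a half-period ℘' = 0 removes the ζ term, so the branch points satisfy a closed quadratic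
system. -/
lemma hasDerivAt_branch₁ (τ : ℍ) : HasDerivAt branch₁ (heatConst *
    (2 * ((branch₁ τ - branch₂ τ) * (branch₁ τ - branch₃ τ)) - 2 * branch₁ τ ^ 2)) τ := by
  have h := hasDerivAt_shiftedP_comp (δ := fun _ => 1 / 2) (offLattice_half₁ τ)
    (hasDerivAt_const (τ : ℂ) (1 / 2 : ℂ))
  rw [partial₁_partial₁_shiftedP (offLattice_half₁ τ), partial₁_shiftedP (offLattice_half₁ τ),
    wpDeriv, derivWeierstrassP_half (isHalfPeriods τ).two₁] at h
  convert! h using 1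
  rw [show shiftedP (1 / 2, (τ : ℂ)) = branch₁ τ from rfl]
  ring

lemma hasDerivAt_branch₂ (τ : ℍ) : HasDerivAt branch₂ (heatConst *
    (2 * ((branch₂ τ - branch₁ τ) * (branch₂ τ - branch₃ τ)) - 2 * branch₂ τ ^ 2)) τ := by
  have h := hasDerivAt_shiftedP_comp (δ := fun s => -(1 / 2) - s / 2) (offLattice_half₂ τ)
    (((hasDerivAt_id (τ : ℂ)).div_const 2).const_sub (-(1 / 2)))
  rw [partial₁_partial₁_shiftedP (offLattice_half₂ τ), partial₁_shiftedP (offLattice_half₂ τ),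
    wpDeriv, derivWeierstrassP_half (isHalfPeriods τ).two₂] at h
  convert! h using 1
  rw [show shiftedP (-(1 / 2) - (τ : ℂ) / 2, (τ : ℂ)) = branch₂ τ from rfl]
  ring

lemma hasDerivAt_branch₃ (τ : ℍ) : HasDerivAt branch₃ (heatConst *
    (2 * ((branch₃ τ - branch₁ τ) * (branch₃ τ - branch₂ τ)) - 2 * branch₃ τ ^ 2)) τ := by
  have h := hasDerivAt_shiftedP_comp (δ := fun s => s / 2) (offLattice_half₃ τ)
    ((hasDerivAt_id (τ : ℂ)).div_const 2)
  rw [partial₁_partial₁_shiftedP (offLattice_half₃ τ), partial₁_shiftedP (offLattice_half₃ τ),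
    wpDeriv, derivWeierstrassP_half (isHalfPeriods τ).two₃] at h
  convert! h using 1
  rw [show shiftedP ((τ : ℂ) / 2, (τ : ℂ)) = branch₃ τ from rfl]
  ring

lemma hasDerivAt_gap (τ : ℍ) :
    HasDerivAt gap (-4 * heatConst * (branch₁ τ + gap τ * modT τ) * gap τ) τ := by
  convert! (hasDerivAt_branch₂ τ).sub (hasDerivAt_branch₁ τ) using 1
  rw [branch₃_eq _ (gap_ne_zero τ), branch₂_eq]
  ring

lemma hasDerivAt_modT (τ : ℍ) :
    HasDerivAt modT (4 * heatConst * gap τ * modT τ * (modT τ - 1)) τ := by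
  convert! ((hasDerivAt_branch₃ τ).sub (hasDerivAt_branch₁ τ)).div (hasDerivAt_gap τ)
    (gap_ne_zero τ) using 1
  have h := gap_ne_zero τ
  simp only [Pi.sub_apply]
  rw [branch₃_eq _ h, branch₂_eq]
  field_simp
  ring

lemma hasDerivAt_normP_comp {δ : ℂ → ℂ} {δ' : ℂ} (h : (δ τ, (τ : ℂ)) ∈ offLattice)
    (hδ : HasDerivAt δ δ' τ) :
    HasDerivAt (fun s => normP (δ s, s)) (partial₁ shiftedP (δ τ, τ) *
      (δ' + 2 * heatConst * zeta (δ τ, τ)) / gap τ +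
      4 * heatConst * gap τ * normP (δ τ, τ) * (normP (δ τ, τ) - 1)) τ := by
  have hg := gap_ne_zero τ
  convert! ((hasDerivAt_shiftedP_comp h hδ).sub (hasDerivAt_branch₁ τ)).div (hasDerivAt_gap τ)
    hg using 1
  rw [partial₁_partial₁_shiftedP h]
  simp only [Pi.sub_apply]
  rw [shiftedP_eq _ hg, branch₃_eq _ hg, branch₂_eq]
  generalize gap (τ : ℂ) = a at *
  generalize modT (τ : ℂ) = T at *
  generalize branch₁ (τ : ℂ) = E at *
  generalize normP (δ τ, (τ : ℂ)) = X at *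
  generalize partial₁ shiftedP (δ τ, (τ : ℂ)) = y at *
  field_simp
  ring

end

/-! ### The numerical constant and the algebraic elimination. -/

lemma heatConst_sq : 4 * heatConst ^ 2 = -(1 / (4 * (Real.pi : ℂ) ^ 2)) := by
  have h : (Real.pi : ℂ) ≠ 0 := by exact_mod_cast Real.pi_ne_zero
  rw [heatConst, div_pow, mul_pow, mul_pow, Complex.I_sq]
  field_simp

lemma heatConst_ne_zero : heatConst ≠ 0 := by
  have h : (Real.pi : ℂ) ≠ 0 := by exact_mod_cast Real.pi_ne_zero
  simp [heatConst, h]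

/-- The elimination of the derivatives of `λ` in terms of those of `δ`. -/
lemma pvi_identity {X T a c E w W A T' X₁ X₂ T₂ L₁ L₂ κ₀ κ₁ κt κinf : ℂ}
    (ha : a ≠ 0) (hc : c ≠ 0) (hT : T ≠ 0) (hT1 : T - 1 ≠ 0)
    (hX : X ≠ 0) (hX1 : X - 1 ≠ 0) (hXT : X - T ≠ 0)
    (hA : A = -4 * c * (E + a * T) * a) (hT' : T' = 4 * c * a * T * (T - 1))
    (hX₁ : X₁ = w + 4 * c * a * X * (X - 1))
    (hX₂ : X₂ = w * (1 / 2 * (3 * A / a + X₁ / X + X₁ / (X - 1) + (X₁ - T') / (X - T)) - A / a -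
        2 * c * (E + a * X)) + W - 8 * c ^ 2 * a ^ 2 * X * (X - 1) * (X - T) +
        4 * c * A * X * (X - 1) + 4 * c * a * X₁ * (2 * X - 1))
    (hT₂ : T₂ = 4 * c * A * T * (T - 1) + 4 * c * a * T' * (2 * T - 1))
    (hL₁ : L₁ * T' = X₁) (hL₂ : L₂ * T' ^ 2 + L₁ * T₂ = X₂) :
    (L₂ - (1 / 2 * (1 / X + 1 / (X - 1) + 1 / (X - T)) * L₁ ^ 2
      - (1 / T + 1 / (T - 1) + 1 / (X - T)) * L₁
      + X * (X - 1) * (X - T) / (T ^ 2 * (T - 1) ^ 2) *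
        (κinf ^ 2 / 2 - κ₀ ^ 2 / 2 * (T / X ^ 2)
          + κ₁ ^ 2 / 2 * ((T - 1) / (X - 1) ^ 2)
          + (1 - κt ^ 2) / 2 * (T * (T - 1) / (X - T) ^ 2)))) * T' ^ 2 =
    W - 8 * c ^ 2 * a ^ 2 * X * (X - 1) * (X - T) * (κinf ^ 2 - κ₀ ^ 2 * (T / X ^ 2) +
      κ₁ ^ 2 * ((T - 1) / (X - 1) ^ 2) - κt ^ 2 * (T * (T - 1) / (X - T) ^ 2)) := by
  have hT'0 : T' ≠ 0 := by
    rw [hT']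
    exact mul_ne_zero (mul_ne_zero (mul_ne_zero (mul_ne_zero (by norm_num) hc) ha) hT) hT1
  -- Once L₁ and L₂ are expressed through X₁, X₂, T' and T₂, the claim is a rational identity in
  -- which w cancels. In the application w = y(δ' + 2cζ)/a and W = yδ''/a.
  have e₁ : L₁ = X₁ / T' := by rw [← hL₁]; field_simp
  have e₂ : L₂ = (X₂ - L₁ * T₂) / T' ^ 2 := by rw [← hL₂]; field_simp; ring
  rw [e₂, e₁, hX₂, hT₂, hX₁, hT', hA]
  field_simp
  ring

end EllipticPVI

namespace EllipticPVI

open Filter Set ContDiff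

/-! ### Local correspondence between `δ` and `λ` -/

lemma analyticAt_of_contDiffAt {f : ℂ → ℂ} {z : ℂ} (h : ContDiffAt ℂ ∞ f z) :
    AnalyticAt ℂ f z := by
  have h1 : ContDiffAt ℂ 1 f z := h.of_le (by simp)
  rw [Complex.analyticAt_iff_eventually_differentiableAt]
  filter_upwards [h1.eventually (by simp)] with y hy
  exact hy.differentiableAt (by simp)

lemma eventually_nhds_coe_iff {τ₀ : ℍ} {p : ℂ → Prop} :
    (∀ᶠ τ : ℍ in 𝓝 τ₀, p τ) ↔ ∀ᶠ s in 𝓝 (τ₀ : ℂ), p s := by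
  rw [← UpperHalfPlane.isOpenEmbedding_coe.map_nhds_eq, eventually_map]

lemma eventually_exists_coe (τ₀ : ℍ) : ∀ᶠ s in 𝓝 (τ₀ : ℂ), ∃ τ : ℍ, (τ : ℂ) = s :=
  eventually_nhds_coe_iff.1 (.of_forall fun τ => ⟨τ, rfl⟩)

lemma eventually_offLattice_comp {τ₀ : ℍ} {δ : ℂ → ℂ} (hδ : ContinuousAt δ τ₀)
    (h : (δ τ₀, (τ₀ : ℂ)) ∈ offLattice) : ∀ᶠ s in 𝓝 (τ₀ : ℂ), (δ s, s) ∈ offLattice :=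
  (hδ.prodMk continuousAt_id).eventually (eventually_offLattice h)

lemma related_iff {τ₀ : ℍ} {δ lam : ℂ → ℂ} (hδ : ContinuousAt δ τ₀)
    (h : (δ τ₀, (τ₀ : ℂ)) ∈ offLattice) :
    Related τ₀ δ lam ↔ ∀ᶠ s in 𝓝 (τ₀ : ℂ), lam (modT s) = normP (δ s, s) := by
  rw [← eventually_nhds_coe_iff, Related]
  refine eventually_congr ?_
  filter_upwards [eventually_nhds_coe_iff.2 (eventually_offLattice_comp hδ h)] with τ hτ
  rw [tMod_eq, wp_sub_div_eq hτ]

lemma contDiffAt_branch₁ (τ : ℍ) : ContDiffAt ℂ ∞ branch₁ τ :=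
  ContDiffAt.comp (τ : ℂ) (g := shiftedP) (f := fun s => (1 / 2, s))
    (contDiffAt_shiftedP (offLattice_half₁ τ)) (by fun_prop)

lemma contDiffAt_gap (τ : ℍ) : ContDiffAt ℂ ∞ gap τ :=
  (ContDiffAt.comp (τ : ℂ) (g := shiftedP) (f := fun s => (-(1 / 2) - s / 2, s))
    (contDiffAt_shiftedP (offLattice_half₂ τ)) (by fun_prop)).sub (contDiffAt_branch₁ τ)

lemma contDiffAt_modT (τ : ℍ) : ContDiffAt ℂ ∞ modT τ :=
  ((ContDiffAt.comp (τ : ℂ) (g := shiftedP) (f := fun s => (s / 2, s))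
    (contDiffAt_shiftedP (offLattice_half₃ τ)) (by fun_prop)).sub (contDiffAt_branch₁ τ)).div
    (contDiffAt_gap τ) (gap_ne_zero τ)

lemma deriv_modT_ne_zero (τ : ℍ) : deriv modT τ ≠ 0 := by
  rw [(hasDerivAt_modT τ).deriv]
  exact mul_ne_zero (mul_ne_zero (mul_ne_zero (mul_ne_zero (by norm_num) heatConst_ne_zero)
    (gap_ne_zero τ)) (modT_ne_zero τ)) (sub_ne_zero.2 (modT_ne_one τ))

lemma contDiffAt_normP_comp {τ : ℍ} {δ : ℂ → ℂ} (hδ : AnalyticAt ℂ δ τ)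
    (h : (δ τ, (τ : ℂ)) ∈ offLattice) : ContDiffAt ℂ ∞ (fun s => normP (δ s, s)) τ :=
  ((ContDiffAt.comp (τ : ℂ) (g := shiftedP) (f := fun s => (δ s, s)) (contDiffAt_shiftedP h)
    (hδ.contDiffAt.prodMk contDiffAt_id)).sub (contDiffAt_branch₁ τ)).div
    (contDiffAt_gap τ) (gap_ne_zero τ)

theorem exists_related_of_delta {τ₀ : ℍ} {δ : ℂ → ℂ} (hδ : AnalyticAt ℂ δ τ₀)
    (h : δ τ₀ ∉ (periods τ₀).lattice) :
    ∃ lam : ℂ → ℂ, AnalyticAt ℂ lam (tMod τ₀) ∧ Related τ₀ δ lam := by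
  rw [notMem_lattice_iff] at h
  have hT := analyticAt_of_contDiffAt (contDiffAt_modT τ₀)
  have hT' := deriv_modT_ne_zero τ₀
  have hX := analyticAt_of_contDiffAt (contDiffAt_normP_comp hδ h)
  let r := hT.hasStrictDerivAt.localInverse _ _ _ hT'
  have hr : AnalyticAt ℂ r (modT τ₀) := hT.analyticAt_localInverse hT'
  have hr0 : r (modT τ₀) = τ₀ := HasStrictFDerivAt.localInverse_apply_image ..
  refine ⟨fun t => normP (δ (r t), r t), ?_, (related_iff hδ.continuousAt h).2 ?_⟩
  · rw [tMod_eq]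
    exact AnalyticAt.fun_comp (g := fun s => normP (δ s, s)) (f := r) (by rwa [hr0]) hr
  · have := HasStrictDerivAt.eventually_left_inverse (hf := hT.hasStrictDerivAt) (hf' := hT')
    filter_upwards [this] with s hs
    have hs' : r (modT s) = s := hs
    rw [hs']

/-- This is where λ ∉ {0, 1, t} enters: these are the branch values of the normalised ℘. -/
lemma partial₁_shiftedP_ne_zero {τ : ℍ} {z : ℂ} (h : (z, (τ : ℂ)) ∈ offLattice)
    (h0 : normP (z, τ) ≠ 0) (h1 : normP (z, τ) ≠ 1) (ht : normP (z, τ) ≠ modT τ) :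
    partial₁ shiftedP (z, τ) ≠ 0 := by
  intro hz
  have := partial₁_shiftedP_sq h
  rw [hz, zero_pow two_ne_zero, eq_comm] at this
  exact mul_ne_zero (mul_ne_zero (by norm_num) (pow_ne_zero 3 (gap_ne_zero τ)))
    (mul_ne_zero (mul_ne_zero h0 (sub_ne_zero.2 h1)) (sub_ne_zero.2 ht)) this

lemma exists_normP_eq (τ : ℍ) (x : ℂ) : ∃ z, (z, (τ : ℂ)) ∈ offLattice ∧ normP (z, τ) = x := by
  obtain ⟨C, -, -, -, h4⟩ := exists_wp_branch_eq τ
  obtain ⟨z, hz, hzx⟩ := exists_weierstrassP_eq_const (periods τ) (branch₁ τ + gap τ * x + C)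
  rw [notMem_lattice_iff] at hz
  have h5 : shiftedP (z, τ) = branch₁ τ + gap τ * x :=
    add_right_cancel ((h4 z hz).symm.trans hzx)
  refine ⟨z, hz, ?_⟩
  have := gap_ne_zero τ
  rw [normP, h5]
  field_simp
  ring

theorem exists_related_of_lam {τ₀ : ℍ} {lam : ℂ → ℂ} (hlam : AnalyticAt ℂ lam (tMod τ₀))
    (h0 : lam (tMod τ₀) ≠ 0) (h1 : lam (tMod τ₀) ≠ 1) (ht : lam (tMod τ₀) ≠ tMod τ₀) :
    ∃ δ : ℂ → ℂ, AnalyticAt ℂ δ τ₀ ∧ δ τ₀ ∉ (periods τ₀).lattice ∧ Related τ₀ δ lam := by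
  rw [tMod_eq] at *
  obtain ⟨z₀, hz₀, hx⟩ := exists_normP_eq τ₀ (lam (modT τ₀))
  rw [← hx] at h0 h1 ht
  have hne := partial₁_shiftedP_ne_zero hz₀ h0 h1 ht
  let W : ℂ → ℂ := fun s => branch₁ s + gap s * lam (modT s)
  have hW : ContDiffAt ℂ ∞ W τ₀ := (contDiffAt_branch₁ τ₀).add ((contDiffAt_gap τ₀).mul
    (ContDiffAt.comp (τ₀ : ℂ) (g := lam) hlam.contDiffAt (contDiffAt_modT τ₀)))
  -- The variables are swapped because the implicit function solves for the second coordinate, here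
  -- z; invertibility is ℘'(z₀) ≠ 0.
  let f : ℂ × ℂ → ℂ := fun q => shiftedP (q.2, q.1) - W q.1
  have hf : ContDiffAt ℂ ∞ f ((τ₀ : ℂ), z₀) :=
    (ContDiffAt.comp ((τ₀ : ℂ), z₀) (g := shiftedP) (f := fun q : ℂ × ℂ => (q.2, q.1))
      (contDiffAt_shiftedP hz₀) (by fun_prop)).sub
      (ContDiffAt.comp ((τ₀ : ℂ), z₀) (g := W) hW contDiffAt_fst)
  have hinv : (fderiv ℂ f ((τ₀ : ℂ), z₀) ∘L .inr ℂ ℂ ℂ).IsInvertible := by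
    refine ⟨ContinuousLinearEquiv.unitsEquivAut ℂ (Units.mk0 _ hne), ?_⟩
    ext
    have h2 := (hf.differentiableAt (by simp)).hasFDerivAt.comp_hasDerivAt z₀
      ((hasDerivAt_const z₀ (τ₀ : ℂ)).prodMk (hasDerivAt_id z₀))
    have h3 := (hasDerivAt_wp hz₀).sub_const (W τ₀)
    have h4 := h3.unique h2
    simpa using h4
  let δ := hf.implicitFunction (by simp) hinv
  have hδ0 : δ τ₀ = z₀ := hf.implicitFunction_apply_self (by simp) hinv
  have hδ : AnalyticAt ℂ δ τ₀ :=
    analyticAt_of_contDiffAt (hf.contDiffAt_implicitFunction (by simp) hinv)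
  have hoff : (δ τ₀, (τ₀ : ℂ)) ∈ offLattice := by rwa [hδ0]
  refine ⟨δ, hδ, notMem_lattice_iff.2 hoff, (related_iff hδ.continuousAt hoff).2 ?_⟩
  have hg := gap_ne_zero τ₀
  have hf0 : f ((τ₀ : ℂ), z₀) = 0 := by
    simp only [f, W]
    rw [shiftedP_eq _ hg, hx, sub_self]
  filter_upwards [hf.eventually_apply_implicitFunction (by simp) hinv,
    (contDiffAt_gap τ₀).continuousAt.eventually_ne hg] with s hs hgs
  rw [hf0] at hs
  have hs' : shiftedP (δ s, s) = branch₁ s + gap s * lam (modT s) := sub_eq_zero.1 hs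
  rw [normP, hs']
  simp only
  field_simp
  ring

/-! ### Equivalence of the two equations -/

lemma wp_eq_of_add_mem {τ : ℍ} {z h : ℂ} (hz : z + h ∈ (periods τ).lattice) :
    wp τ z = wp τ h := by
  have := weierstrassP_add (periods τ) (-h) hz
  rwa [show -h + (z + h) = z by ring, PeriodPair.weierstrassP_neg] at this

lemma wpDeriv_add_half {τ : ℍ} {z : ℂ} (h : (z, (τ : ℂ)) ∈ offLattice)
    (h0 : normP (z, τ) ≠ 0) (h1 : normP (z, τ) ≠ 1) (ht : normP (z, τ) ≠ modT τ) :
    wpDeriv τ (z + 1 / 2) = -(modT τ * partial₁ shiftedP (z, τ) / normP (z, τ) ^ 2) ∧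
    wpDeriv τ (z + ((τ : ℂ) + 1) / 2) =
      (modT τ - 1) * partial₁ shiftedP (z, τ) / (normP (z, τ) - 1) ^ 2 ∧
    wpDeriv τ (z + (τ : ℂ) / 2) =
      -(modT τ * (modT τ - 1) * partial₁ shiftedP (z, τ) / (normP (z, τ) - modT τ) ^ 2) := by
  obtain ⟨C, E1, E2, E3, hC⟩ := exists_wp_branch_eq τ
  have hh := isHalfPeriods τ
  have hg := gap_ne_zero τ
  have hz := notMem_lattice_iff.2 h
  have d1 : wp τ z - e₁ τ = gap τ * normP (z, τ) := by
    rw [hC z h, E1, shiftedP_eq _ hg]; ring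
  have d2 : wp τ z - e₂ τ = gap τ * (normP (z, τ) - 1) := by
    rw [hC z h, E2, shiftedP_eq _ hg, branch₂_eq]; ring
  have d3 : wp τ z - e₃ τ = gap τ * (normP (z, τ) - modT τ) := by
    rw [hC z h, E3, shiftedP_eq _ hg, branch₃_eq _ hg]; ring
  have d21 : e₂ τ - e₁ τ = gap τ := by rw [E1, E2, branch₂_eq]; ring
  have d31 : e₃ τ - e₁ τ = gap τ * modT τ := by rw [E1, E3, branch₃_eq _ hg]; ring
  have d32 : e₃ τ - e₂ τ = gap τ * (modT τ - 1) := by linear_combination d31 - d21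
  have m1 := mul_ne_zero hg h0
  have m2 := mul_ne_zero hg (sub_ne_zero.2 h1)
  have m3 := mul_ne_zero hg (sub_ne_zero.2 ht)
  -- If z plus a half-period were a lattice point, ℘(z) would be the corresponding branch value.
  have n1 : z + 1 / 2 ∉ (periods τ).lattice := fun hm => m1 (by
    rw [← d1, wp_eq_of_add_mem hm, e₁, sub_self])
  have n2 : z + (-(1 / 2) - (τ : ℂ) / 2) ∉ (periods τ).lattice := fun hm => m2 (by
    rw [← d2, wp_eq_of_add_mem hm, e₂, sub_self])
  have n3 : z + (τ : ℂ) / 2 ∉ (periods τ).lattice := fun hm => m3 (by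
    rw [← d3, wp_eq_of_add_mem hm, e₃, sub_self])
  have k1 : (wp τ z - e₁ τ) ^ 2 * wpDeriv τ (z + 1 / 2) =
      -((e₂ τ - e₁ τ) * (e₃ τ - e₁ τ) * wpDeriv τ z) := hh.derivWeierstrassP_add hz n1
  have k2 : (wp τ z - e₂ τ) ^ 2 * wpDeriv τ (z + (-(1 / 2) - (τ : ℂ) / 2)) =
      -((e₃ τ - e₂ τ) * (e₁ τ - e₂ τ) * wpDeriv τ z) := hh.rotate.derivWeierstrassP_add hz n2
  have k3 : (wp τ z - e₃ τ) ^ 2 * wpDeriv τ (z + (τ : ℂ) / 2) =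
      -((e₁ τ - e₃ τ) * (e₂ τ - e₃ τ) * wpDeriv τ z) :=
    hh.rotate.rotate.derivWeierstrassP_add hz n3
  -- The half-periods (τ + 1)/2 and -1/2 - τ/2 differ by the period 1 + τ.
  have hshift : wpDeriv τ (z + ((τ : ℂ) + 1) / 2) =
      wpDeriv τ (z + (-(1 / 2) - (τ : ℂ) / 2)) := by
    have := derivWeierstrassP_add (periods τ) (z + (-(1 / 2) - (τ : ℂ) / 2))
      (add_mem (one_mem_lattice τ) (tau_mem_lattice τ))
    rw [← show z + ((τ : ℂ) + 1) / 2 = z + (-(1 / 2) - (τ : ℂ) / 2) + (1 + τ) by ring] at this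
    exact this
  rw [← partial₁_shiftedP h] at k1 k2 k3
  rw [hshift]
  rw [d1, d21, d31] at k1
  rw [d2, d32, ← neg_sub (e₂ τ), d21] at k2
  rw [d3, ← neg_sub (e₃ τ), d31, ← neg_sub (e₃ τ), d32] at k3
  have q0 := h0
  have q1 := sub_ne_zero.2 h1
  have qt := sub_ne_zero.2 ht
  refine ⟨?_, ?_, ?_⟩
  · apply mul_left_cancel₀ (pow_ne_zero 2 m1)
    rw [k1]
    field_simp
  · apply mul_left_cancel₀ (pow_ne_zero 2 m2)
    rw [k2]
    field_simp
  · apply mul_left_cancel₀ (pow_ne_zero 2 m3)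
    rw [k3]
    field_simp

theorem pviAt_iff_ellipticPVIAt {κ₀ κ₁ κt κinf : ℂ} {τ₀ : ℍ} {δ lam : ℂ → ℂ}
    (hδ : AnalyticAt ℂ δ τ₀) (hmem : δ τ₀ ∉ (periods τ₀).lattice)
    (hlam : AnalyticAt ℂ lam (tMod τ₀))
    (h0 : lam (tMod τ₀) ≠ 0) (h1 : lam (tMod τ₀) ≠ 1) (ht : lam (tMod τ₀) ≠ tMod τ₀)
    (hrel : Related τ₀ δ lam) :
    PVIAt κ₀ κ₁ κt κinf lam (tMod τ₀) ↔ EllipticPVIAt κ₀ κ₁ κt κinf δ τ₀ := by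
  rw [tMod_eq] at *
  rw [notMem_lattice_iff] at hmem
  rw [related_iff hδ.continuousAt hmem] at hrel
  have hx := hrel.self_of_nhds
  rw [hx] at h0 h1 ht
  have hg := gap_ne_zero τ₀
  have hTcont := (contDiffAt_modT τ₀).continuousAt
  -- The first-order relation is needed on a whole neighbourhood, since it is differentiated once
  -- more below.
  have hfirst : (fun s => deriv lam (modT s) * (4 * heatConst * gap s * modT s * (modT s - 1)))
      =ᶠ[𝓝 (τ₀ : ℂ)] fun s => partial₁ shiftedP (δ s, s) *
        (deriv δ s + 2 * heatConst * zeta (δ s, s)) / gap s +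
        4 * heatConst * gap s * normP (δ s, s) * (normP (δ s, s) - 1) := by
    filter_upwards [eventually_eventually_nhds.2 hrel, eventually_exists_coe τ₀,
      eventually_offLattice_comp hδ.continuousAt hmem, hδ.eventually_analyticAt,
      hTcont.eventually hlam.eventually_analyticAt] with s hs hτ hoff hδs hlams
    obtain ⟨τ, rfl⟩ := hτ
    have d1 := hlams.differentiableAt.hasDerivAt.comp (τ : ℂ) (hasDerivAt_modT τ)
    exact d1.unique ((hasDerivAt_normP_comp hoff
      hδs.differentiableAt.hasDerivAt).congr_of_eventuallyEq hs)
  have hT := hasDerivAt_modT τ₀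
  have ha := hasDerivAt_gap τ₀
  have hD1 := hδ.differentiableAt.hasDerivAt
  have hX := hasDerivAt_normP_comp hmem hD1
  have hZ := hasDerivAt_zeta_comp hmem hD1
  have hD2 := hδ.deriv.differentiableAt.hasDerivAt
  have hL := hlam.deriv.differentiableAt.hasDerivAt.comp (τ₀ : ℂ) hT
  have hy : HasDerivAt (fun s => partial₁ shiftedP (δ s, s)) _ (τ₀ : ℂ) :=
    hasDerivAt_comp_curve (F := partial₁ shiftedP) (v := fun s => s) (s := (τ₀ : ℂ))
    ((contDiffAt_partial₁ (contDiffAt_shiftedP hmem)).differentiableAt (by simp))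
    hD1 (hasDerivAt_id (τ₀ : ℂ))
  have hsq : (fun s => partial₁ shiftedP (δ s, s) ^ 2) =ᶠ[𝓝 (τ₀ : ℂ)]
      fun s => 4 * gap s ^ 3 *
        (normP (δ s, s) * (normP (δ s, s) - 1) * (normP (δ s, s) - modT s)) := by
    filter_upwards [eventually_exists_coe τ₀,
      eventually_offLattice_comp hδ.continuousAt hmem] with s hτ hoff
    obtain ⟨τ, rfl⟩ := hτ
    exact partial₁_shiftedP_sq hoff
  -- The derivative of y along the curve is obtained from y² = 4a³X(X - 1)(X - T), avoiding the
  -- τ-derivative of ℘'.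
  have hq := (hy.pow 2).unique ((((ha.pow 3).const_mul 4).mul
    ((hX.mul (hX.sub_const 1)).mul (hX.sub hT))).congr_of_eventuallyEq hsq)
  have hsq0 := hsq.self_of_nhds
  have hfst0 := hfirst.self_of_nhds
  have hsecond := (hL.mul (((ha.const_mul (4 * heatConst)).mul hT).mul
    (hT.sub_const 1))).unique ((((hy.mul (hD2.add (hZ.const_mul (2 * heatConst)))).div ha hg).add
      (((ha.const_mul (4 * heatConst)).mul hX).mul (hX.sub_const 1))).congr_of_eventuallyEq hfirst)
  have hyne := partial₁_shiftedP_ne_zero hmem h0 h1 ht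
  obtain ⟨w1, w2, w3⟩ := wpDeriv_add_half hmem h0 h1 ht
  rw [PVIAt, EllipticPVIAt, w1, w2, w3, ← partial₁_shiftedP hmem, hx, ← heatConst_sq]
  have hT0 := modT_ne_zero τ₀
  have hT1 := sub_ne_zero.2 (modT_ne_one τ₀)
  have hc := heatConst_ne_zero
  have hX1 := sub_ne_zero.2 h1
  have hXT := sub_ne_zero.2 ht
  have hp := shiftedP_eq (δ τ₀) hg
  simp only [Pi.mul_apply, Pi.add_apply, Pi.sub_apply, Pi.pow_apply, Function.comp_apply] at *
  rw [hp] at hsecond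
  generalize partial₁ (partial₁ shiftedP) (δ ↑τ₀, (τ₀ : ℂ)) * deriv δ (τ₀ : ℂ) +
    partial₂ (partial₁ shiftedP) (δ ↑τ₀, (τ₀ : ℂ)) * 1 = q at *
  clear hy hsq hfirst hL hD2 hZ hX hD1 ha hT hTcont hrel w1 w2 w3 hp hx hmem hlam hδ
  generalize partial₁ shiftedP (δ τ₀, (τ₀ : ℂ)) = y at *
  generalize zeta (δ τ₀, (τ₀ : ℂ)) = ζ at *
  generalize normP (δ τ₀, (τ₀ : ℂ)) = X at *
  generalize deriv (deriv lam) (modT τ₀) = L₂ at *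
  generalize deriv lam (modT τ₀) = L₁ at *
  generalize deriv (deriv δ) (τ₀ : ℂ) = D at *
  generalize deriv δ (τ₀ : ℂ) = D₁ at *
  generalize modT (τ₀ : ℂ) = T at *
  generalize gap (τ₀ : ℂ) = a at *
  generalize branch₁ (τ₀ : ℂ) = E at *
  generalize heatConst = c at *
  -- From here on δ' and ζ survive only through v.
  generalize D₁ + 2 * c * ζ = v at *
  obtain ⟨A, hA⟩ : ∃ A, A = -4 * c * (E + a * T) * a := ⟨_, rfl⟩
  obtain ⟨T', hT'⟩ : ∃ T', T' = 4 * c * a * T * (T - 1) := ⟨_, rfl⟩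
  obtain ⟨X₁, hX₁⟩ : ∃ X₁, X₁ = y * v / a + 4 * c * a * X * (X - 1) := ⟨_, rfl⟩
  rw [← hX₁, ← hT', ← hA] at hsecond hq
  rw [← hT', ← hX₁] at hfst0
  -- The logarithmic derivative of y² = 4a³X(X - 1)(X - T), with A = a'.
  have hqe : q = y * (1 / 2 * (3 * A / a + X₁ / X + X₁ / (X - 1) + (X₁ - T') / (X - T))) := by
    apply mul_left_cancel₀ (mul_ne_zero two_ne_zero hyne)
    calc 2 * y * q = 2 * y ^ (2 - 1) * q := by norm_num
      _ = y ^ 2 * (3 * A / a + X₁ / X + X₁ / (X - 1) + (X₁ - T') / (X - T)) := by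
        rw [hsq0]
        push_cast at hq
        rw [hq]
        field_simp
        ring
      _ = _ := by ring
  have key := pvi_identity (W := y / a * D) (L₂ := L₂) (κ₀ := κ₀) (κ₁ := κ₁) (κt := κt) (κinf := κinf)
    hg hc hT0 hT1 h0 hX1 hXT hA hT' hX₁ rfl rfl hfst0 (by
      rw [hqe] at hsecond
      have h8 : 8 * c ^ 2 * a ^ 2 * X * (X - 1) * (X - T) = 2 * c ^ 2 * y ^ 2 / a := by
        rw [hsq0]
        field_simp
        ring
      rw [h8]
      convert hsecond using 1
      · ring
      · generalize 1 / 2 * (3 * A / a + X₁ / X + X₁ / (X - 1) + (X₁ - T') / (X - T)) = ρ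
        field_simp
        ring)
  have hT'0 : T' ≠ 0 := by
    rw [hT']
    exact mul_ne_zero (mul_ne_zero (mul_ne_zero (mul_ne_zero (by norm_num) hc) hg) hT0) hT1
  have h8 : 8 * c ^ 2 * a ^ 2 * X * (X - 1) * (X - T) = y / a * (2 * c ^ 2 * y) := by
    calc _ = 2 * c ^ 2 * (4 * a ^ 3 * (X * (X - 1) * (X - T))) / a := by
          field_simp
          ring
      _ = _ := by rw [← hsq0]; ring
  rw [h8] at key
  -- The factor y/a comes out, leaving the defect of the elliptic equation; as y/a and T'² are
  -- nonzero, the two defects vanish together.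
  have hR : y / a * D - y / a * (2 * c ^ 2 * y) * (κinf ^ 2 - κ₀ ^ 2 * (T / X ^ 2) +
      κ₁ ^ 2 * ((T - 1) / (X - 1) ^ 2) - κt ^ 2 * (T * (T - 1) / (X - T) ^ 2)) =
    y / a * (D - 4 * c ^ 2 *
        (κinf ^ 2 / 2 * y + κ₀ ^ 2 / 2 * -(T * y / X ^ 2) +
          κ₁ ^ 2 / 2 * ((T - 1) * y / (X - 1) ^ 2) +
          κt ^ 2 / 2 * -(T * (T - 1) * y / (X - T) ^ 2))) := by ring
  rw [hR] at key
  rw [← sub_eq_zero, ← sub_eq_zero (a := D)]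
  constructor
  · intro h
    rw [h, zero_mul] at key
    exact (mul_eq_zero.1 key.symm).resolve_left (div_ne_zero hyne hg)
  · intro h
    rw [h, mul_zero] at key
    exact (mul_eq_zero.1 key).resolve_right (pow_ne_zero 2 hT'0)

end EllipticPVI

theorem mainTheorem1 (κ₀ κ₁ κt κinf : ℂ) (τ₀ : ℍ) :
    -- every `δ` defines a `λ` as a function of `t`
    (∀ δ : ℂ → ℂ, AnalyticAt ℂ δ τ₀ → δ τ₀ ∉ (EllipticPVI.periods τ₀).lattice →
      ∃ lam : ℂ → ℂ, AnalyticAt ℂ lam (EllipticPVI.tMod τ₀) ∧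
        EllipticPVI.Related τ₀ δ lam) ∧
    -- every `λ` with `λ ≠ 0, 1, t` arises from some `δ`
    (∀ lam : ℂ → ℂ, AnalyticAt ℂ lam (EllipticPVI.tMod τ₀) →
      lam (EllipticPVI.tMod τ₀) ≠ 0 → lam (EllipticPVI.tMod τ₀) ≠ 1 →
      lam (EllipticPVI.tMod τ₀) ≠ EllipticPVI.tMod τ₀ →
      ∃ δ : ℂ → ℂ, AnalyticAt ℂ δ τ₀ ∧ δ τ₀ ∉ (EllipticPVI.periods τ₀).lattice ∧
        EllipticPVI.Related τ₀ δ lam) ∧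
    -- the two equations are equivalent
    (∀ δ lam : ℂ → ℂ, AnalyticAt ℂ δ τ₀ → δ τ₀ ∉ (EllipticPVI.periods τ₀).lattice →
      AnalyticAt ℂ lam (EllipticPVI.tMod τ₀) →
      lam (EllipticPVI.tMod τ₀) ≠ 0 → lam (EllipticPVI.tMod τ₀) ≠ 1 →
      lam (EllipticPVI.tMod τ₀) ≠ EllipticPVI.tMod τ₀ →
      EllipticPVI.Related τ₀ δ lam →
      (EllipticPVI.PVIAt κ₀ κ₁ κt κinf lam (EllipticPVI.tMod τ₀) ↔
        EllipticPVI.EllipticPVIAt κ₀ κ₁ κt κinf δ τ₀)) := by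
  exact ⟨fun δ hδ h => EllipticPVI.exists_related_of_delta hδ h,
    fun lam hlam h0 h1 ht => EllipticPVI.exists_related_of_lam hlam h0 h1 ht,
    fun δ lam hδ hmem hlam h0 h1 ht hrel =>
      EllipticPVI.pviAt_iff_ellipticPVIAt hδ hmem hlam h0 h1 ht hrel⟩
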